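/- Let $\mathbb{U}$ be the open unit disc and $\hat{\mathbb{C}}$ the Riemann sphere. $H^2$ is the Hilbert space of holomorphic functions $f(z)=\sum_{n\ge 0}\hat f(n)z^n$ on $\mathbb{U}$ with $\|f\|^2=\sum_n|\hat f(n)|^2<\infty$. Let $\varphi$ be a rational function with $\varphi(\mathbb{U})\subset\mathbb{U}$ (we write $\varphi\in\mathrm{Rat}(\mathbb{U})$), let $C_\varphi f=f\circ\varphi$ be the (bounded) composition operator on $H^2$ and $C_\varphi^*$ its adjoint. Let $\rho(z)=1/\bar z$ on $\hat{\mathbb{C}}$ and let $\varphi_e=\rho\circ\varphi\circ\rho$, a rational map of $\hat{\mathbb{C}}$ of the same degree $d\ge 0$ as $\varphi$. A point $w\in\hat{\mathbb{C}}$ is a *regular value* of $\varphi_e$, written $w\in\mathrm{reg}(\varphi_e)$, if $\varphi_e^{-1}(\{w\})$ has exactly $d$ distinct points. Around each $z\in\mathrm{reg}(\varphi_e)\cap\mathbb{U}$ there is a connected open neighborhood in $\mathbb{U}$ on which $d$ distinct branches $\sigma_1,\dots,\sigma_d$ of $\varphi_e^{-1}$ are defined, that is, $d$ distinct holomorphic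 functions with $\varphi_e\circ\sigma_j=\mathrm{id}$. For $h\in H^2$ with $h(0)=0$, let $\Omega_\varphi h$ be the holomorphic function on $\mathbb{U}$ such that $$\Omega_\varphi h(z)=\sum_{j=1}^d\frac{\sigma_j'(z)}{\sigma_j(z)}\,h(\sigma_j(z))\qquad\text{for all } z\in\mathrm{reg}(\varphi_e)\cap\mathbb{U},\ z\ne\varphi_e(0),$$ where $\sigma_1,\dots,\sigma_d$ are the distinct branches of $\varphi_e^{-1}$ near $z$. For $f\in H^2$ let $(Bf)(z)=(f(z)-f(0))/z$ for $z\in\mathbb{U}\setminus\{0\}$ and $(Bf)(0)=f'(0)$. Then the objects above are well defined ($C_\varphi$ is a bounded operator on $H^2$, the branches exist near every regular value in $\mathbb{U}$, and the holomorphic extension $\Omega_\varphi h$ exists), and for each $f\in H^2$: $$C_\varphi^*f(z)=\frac{f(0)}{1-\overline{\varphi(0)}\,z}+z\,\Omega_\varphi[f-f(0)](z)\qquad(z\in\mathbb{U}),$$ and $$C_\varphi^*f(z)=\frac{f(0)}{1-\overline{\varphi(0)}\,z}+z\sum_{j=1}^d\sigma_j'(z)\,(Bf)(\sigma_j(z))\qquad(z\in\mathrm{reg}(\varphi_e)\cap\mathbb{U}),$$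 where $\sigma_1,\dots,\sigma_d$ are any $d$ distinct branches of $\varphi_e^{-1}$ defined on a connected open neighborhood of $z$ in $\mathbb{U}$. -/

import Mathlib

open Polynomial Set
open scoped ComplexConjugate OnePoint

namespace HardyComp

noncomputable section

/-- The open unit disc `𝕌` of the complex plane. -/
abbrev disc : Set ℂ := Metric.ball (0 : ℂ) 1

/-! ### The Hardy space -/

/-- The Hardy space `H²`, presented by Maclaurin coefficients: an element is a square-summable
sequence `(f̂(n))`, with `⟪f, g⟫` and `‖f‖² = ∑ |f̂(n)|²` those of `ℓ²`. The holomorphic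
function on the disc which it is identified with is `H2.ev f`. -/
abbrev H2 : Type := lp (fun _ : ℕ => ℂ) 2

/-- The function `f(z) = ∑ f̂(n) zⁿ` of an element `f` of `H²` (used for `|z| < 1` only). -/
def H2.ev (f : H2) (z : ℂ) : ℂ := ∑' n, f n * z ^ n

/-- The constant function `c` as an element of `H²`. -/
def H2.const (c : ℂ) : H2 := lp.single 2 0 c

/-- The series of `f ∈ H²` converges on the unit disc. -/
theorem H2.hasFPowerSeriesOnBall (f : H2) :
    HasFPowerSeriesOnBall (H2.ev f) (FormalMultilinearSeries.ofScalars ℂ (fun n => f n)) 0 1 := by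
  refine ⟨?_, one_pos, ?_⟩
  · have := FormalMultilinearSeries.le_radius_of_bound
      (FormalMultilinearSeries.ofScalars ℂ (𝕜 := ℂ) (fun n => f n)) (r := 1) ‖f‖ (fun n => by
        simpa using lp.norm_apply_le_norm (by norm_num) f n)
    simpa using this
  · intro y hy
    have hy' : ‖y‖ < 1 := by
      rw [Metric.mem_eball, edist_zero_right] at hy
      simpa [enorm_eq_nnnorm, ← NNReal.coe_lt_coe] using hy
    have hs : Summable (fun n => f n * y ^ n) := by
      refine Summable.of_norm_bounded (g := fun n => ‖f‖ * ‖y‖ ^ n)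
        ((summable_geometric_of_lt_one (norm_nonneg _) hy').mul_left _) (fun n => ?_)
      rw [norm_mul, norm_pow]
      gcongr
      exact lp.norm_apply_le_norm (by norm_num) f n
    simpa [H2.ev, FormalMultilinearSeries.ofScalars_apply_eq, smul_eq_mul, mul_comm] using hs.hasSum

theorem H2.ev_const (c z : ℂ) : H2.ev (H2.const c) z = c := by
  unfold H2.ev H2.const
  rw [tsum_eq_single 0]
  · simp
  · intro n hn
    simp [lp.single_apply, hn]

/-- Every holomorphic function on the disc with square-summable Maclaurin coefficients
is the function of exactly one element of `H2`. -/
theorem H2.existsUnique_ev_eq (F : ℂ → ℂ) (hF : DifferentiableOn ℂ F disc)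
    (hs : Summable fun n : ℕ => ‖iteratedDeriv n F 0 / (n.factorial : ℂ)‖ ^ 2) :
    ∃! f : H2, EqOn (H2.ev f) F disc := by
  refine ⟨⟨fun n => iteratedDeriv n F 0 / (n.factorial : ℂ), memℓp_gen (by simpa using hs)⟩,
    ?_, ?_⟩
  · intro z hz
    have := Complex.hasSum_taylorSeries_on_ball hF hz
    refine Eq.trans (tsum_congr fun n => ?_) this.tsum_eq
    simp [div_eq_inv_mul]
    ring
  · intro g hg
    have key : ∀ f : H2, EqOn (H2.ev f) F disc → ∀ n : ℕ,
        (f n : ℂ) = iteratedDeriv n F 0 / (n.factorial : ℂ) := by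
      intro f hf n
      have h1 := (H2.hasFPowerSeriesOnBall f).hasFPowerSeriesAt
      have h2 : H2.ev f =ᶠ[nhds 0] F :=
        hf.eventuallyEq_of_mem (Metric.ball_mem_nhds _ one_pos)
      have h3 := (h1.congr h2)
      have h4 := h3.analyticAt.hasFPowerSeriesAt
      have h5 := h3.eq_formalMultilinearSeries h4
      have h6 := congrArg (fun p => FormalMultilinearSeries.coeff p n) h5
      simpa [FormalMultilinearSeries.coeff_ofScalars] using h6
    ext n
    exact key g hg n

/-- The backward shift of `F`: `(F(z) - F(0)) / z`, with the value `F'(0)` at `z = 0`. -/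
def backwardShift (F : ℂ → ℂ) (z : ℂ) : ℂ :=
  if z = 0 then deriv F 0 else (F z - F 0) / z

/-! ### Rational maps of the Riemann sphere `OnePoint ℂ` -/

/-- The map of the Riemann sphere given by the quotient `P / Q` (of coprime polynomials). -/
def quotientMap (P Q : ℂ[X]) : OnePoint ℂ → OnePoint ℂ
  | ∞ =>
    let d := max P.natDegree Q.natDegree
    if Q.coeff d = 0 then ∞ else ((P.coeff d / Q.coeff d : ℂ) : OnePoint ℂ)
  | (z : ℂ) => if Q.eval z = 0 then ∞ else ((P.eval z / Q.eval z : ℂ) : OnePoint ℂ)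

/-- `F` is a rational map of the sphere of degree `d`: it is a quotient of relatively prime
polynomials, and `d` is the larger of their degrees. -/
def HasDegree (F : OnePoint ℂ → OnePoint ℂ) (d : ℕ) : Prop :=
  ∃ P Q : ℂ[X], IsCoprime P Q ∧ F = quotientMap P Q ∧ max P.natDegree Q.natDegree = d

/-- `w` is a regular value of the rational map `F`: if `d` is the degree of `F`, then
`F⁻¹({w})` has `d` distinct points. -/
def IsRegularValue (F : OnePoint ℂ → OnePoint ℂ) (w : OnePoint ℂ) : Prop :=
  ∃ d : ℕ, HasDegree F d ∧ (F ⁻¹' {w}).encard = d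

/-- Inversion in the unit circle, `ρ(z) = 1 / conj z`. -/
def inversion : OnePoint ℂ → OnePoint ℂ
  | ∞ => ((0 : ℂ) : OnePoint ℂ)
  | (z : ℂ) => if z = 0 then ∞ else (((conj z)⁻¹ : ℂ) : OnePoint ℂ)

/-- A rational function as a map of the sphere. -/
def sphereMap (φ : RatFunc ℂ) : OnePoint ℂ → OnePoint ℂ := quotientMap φ.num φ.denom

/-- The value of a rational function at a point of the plane that is not a pole. -/
abbrev value (φ : RatFunc ℂ) (z : ℂ) : ℂ := φ.eval (RingHom.id ℂ) z

/-- `Rat(𝕌)`: the rational functions that map the unit disc into itself. -/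
def RatU : Set (RatFunc ℂ) :=
  {φ | ∀ z ∈ disc, φ.denom.eval z ≠ 0 ∧ value φ z ∈ disc}

/-- The exterior map `φₑ = ρ ∘ φ ∘ ρ`. -/
def exteriorMap (φ : RatFunc ℂ) : OnePoint ℂ → OnePoint ℂ :=
  inversion ∘ sphereMap φ ∘ inversion

/-- The exterior map is again rational, of the same degree. -/
theorem hasDegree_exteriorMap (φ : RatFunc ℂ) :
    HasDegree (exteriorMap φ) (max φ.num.natDegree φ.denom.natDegree) := by
  set P := φ.num with hP
  set Q := φ.denom with hQ
  set d := max P.natDegree Q.natDegree with hd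
  have hcop : IsCoprime P Q := φ.isCoprime_num_denom
  have hcop' := (Polynomial.isCoprime_iff_aeval_ne_zero_of_isAlgClosed (k := ℂ) ℂ P Q).1 hcop
  simp only [Polynomial.coe_aeval_eq_eval] at hcop'
  have hQ0 : Q ≠ 0 := φ.denom_ne_zero
  have hPd : P.natDegree ≤ d := le_max_left _ _
  have hQd : Q.natDegree ≤ d := le_max_right _ _
  have htop : P.coeff d ≠ 0 ∨ Q.coeff d ≠ 0 := by
    rcases le_total P.natDegree Q.natDegree with h | h
    · right
      rw [hd, max_eq_right h]
      exact Polynomial.leadingCoeff_ne_zero.2 hQ0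
    · by_cases hP0 : P = 0
      · right
        have : d = Q.natDegree := by
          rw [hd]; apply max_eq_right; simp [hP0]
        rw [this]
        exact Polynomial.leadingCoeff_ne_zero.2 hQ0
      · left
        rw [hd, max_eq_left h]
        exact Polynomial.leadingCoeff_ne_zero.2 hP0
  let r : ℂ[X] → ℂ[X] := fun f => (f.map (starRingEnd ℂ)).reflect d
  have r0 : ∀ f, (r f).eval 0 = conj (f.coeff d) := by
    intro f
    rw [← Polynomial.coeff_zero_eq_eval_zero]
    simp [r, Polynomial.coeff_reflect, Polynomial.revAt_le]
  have rtop : ∀ f, (r f).coeff d = conj (f.eval 0) := by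
    intro f
    rw [← Polynomial.coeff_zero_eq_eval_zero]
    simp [r, Polynomial.coeff_reflect, Polynomial.revAt_le]
  have rne : ∀ f : ℂ[X], f.natDegree ≤ d → ∀ z : ℂ, z ≠ 0 →
      (r f).eval z = conj (f.eval (conj z)⁻¹) * z ^ d := by
    intro f hf z hz
    let _inst : Invertible z⁻¹ := invertibleOfNonzero (inv_ne_zero hz)
    have h := Polynomial.eval₂_reflect_mul_pow (RingHom.id ℂ) z⁻¹ d (f.map (starRingEnd ℂ))
      (by simpa using hf)
    rw [invOf_eq_inv, inv_inv] at h
    change (r f).eval z * _ = (f.map (starRingEnd ℂ)).eval z⁻¹ at h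
    have h2 : (f.map (starRingEnd ℂ)).eval z⁻¹ = conj (f.eval (conj z)⁻¹) := by
      have := Polynomial.eval_map_apply (f := starRingEnd ℂ) (p := f) (x := (conj z)⁻¹)
      simpa using this
    rw [← h2, ← h, mul_assoc, ← mul_pow, inv_mul_cancel₀ hz, one_pow, mul_one]
  have rdeg : ∀ f : ℂ[X], f.natDegree ≤ d → (r f).natDegree ≤ d := by
    intro f hf
    refine Polynomial.natDegree_reflect_le.trans ?_
    simpa using hf
  have hmax : max (r Q).natDegree (r P).natDegree = d := by
    refine le_antisymm (max_le (rdeg Q hQd) (rdeg P hPd)) ?_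
    rcases hcop' 0 with h | h
    · refine le_max_of_le_right (Polynomial.le_natDegree_of_ne_zero ?_)
      rw [rtop]; simpa using h
    · refine le_max_of_le_left (Polynomial.le_natDegree_of_ne_zero ?_)
      rw [rtop]; simpa using h
  refine ⟨r Q, r P, ?_, ?_, hmax⟩
  · rw [Polynomial.isCoprime_iff_aeval_ne_zero_of_isAlgClosed (k := ℂ) ℂ]
    intro z
    simp only [Polynomial.coe_aeval_eq_eval]
    by_cases hz : z = 0
    · subst hz
      rw [r0, r0]
      rcases htop with h | h
      · right; simpa using h
      · left; simpa using h
    · rw [rne Q hQd z hz, rne P hPd z hz]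
      rcases hcop' (conj z)⁻¹ with h | h
      · right
        exact mul_ne_zero (by simpa using h) (pow_ne_zero _ hz)
      · left
        exact mul_ne_zero (by simpa using h) (pow_ne_zero _ hz)
  · funext w
    have hinv : ∀ a b : ℂ, ¬ (a = 0 ∧ b = 0) →
        inversion (if b = 0 then ∞ else ((a / b : ℂ) : OnePoint ℂ)) =
          if conj a = 0 then ∞ else ((conj b / conj a : ℂ) : OnePoint ℂ) := by
      intro a b hab
      by_cases hb : b = 0
      · have ha : a ≠ 0 := fun h => hab ⟨h, hb⟩
        simp [hb, ha, inversion]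
      · by_cases ha : a = 0
        · simp [hb, ha, inversion]
        · simp [hb, ha, inversion]
    cases w using OnePoint.rec with
    | infty =>
      have h1 : exteriorMap φ ∞ =
          inversion (if Q.eval 0 = 0 then ∞ else ((P.eval 0 / Q.eval 0 : ℂ) : OnePoint ℂ)) := rfl
      have h2 : quotientMap (r Q) (r P) ∞ = if (r P).coeff (max (r Q).natDegree (r P).natDegree) = 0
          then ∞ else (((r Q).coeff (max (r Q).natDegree (r P).natDegree) /
            (r P).coeff (max (r Q).natDegree (r P).natDegree) : ℂ) : OnePoint ℂ) := rfl
      rw [h1, h2, hmax, rtop, rtop]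
      apply hinv
      rintro ⟨h, h'⟩
      rcases hcop' 0 with h'' | h'' <;> contradiction
    | coe z =>
      have h2 : quotientMap (r Q) (r P) z = if (r P).eval z = 0 then ∞ else
        (((r Q).eval z / (r P).eval z : ℂ) : OnePoint ℂ) := rfl
      rw [h2]
      by_cases hz : z = 0
      · subst hz
        have h1 : exteriorMap φ ((0 : ℂ) : OnePoint ℂ) =
            inversion (if Q.coeff d = 0 then ∞ else
              ((P.coeff d / Q.coeff d : ℂ) : OnePoint ℂ)) := by
          have : inversion ((0 : ℂ) : OnePoint ℂ) = ∞ := if_pos rfl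
          rw [exteriorMap, Function.comp_apply, Function.comp_apply, this]
          rfl
        rw [h1, r0, r0]
        apply hinv
        rintro ⟨h, h'⟩
        rcases htop with h'' | h'' <;> contradiction
      · have h1 : exteriorMap φ (z : OnePoint ℂ) =
            inversion (if Q.eval (conj z)⁻¹ = 0 then ∞ else
              ((P.eval (conj z)⁻¹ / Q.eval (conj z)⁻¹ : ℂ) : OnePoint ℂ)) := by
          have : inversion (z : OnePoint ℂ) = (((conj z)⁻¹ : ℂ) : OnePoint ℂ) := if_neg hz
          rw [exteriorMap, Function.comp_apply, Function.comp_apply, this]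
          rfl
        rw [h1, rne Q hQd z hz, rne P hPd z hz, mul_div_mul_right _ _ (pow_ne_zero _ hz),
          hinv]
        · simp [hz]
        · rintro ⟨h, h'⟩
          rcases hcop' (conj z)⁻¹ with h'' | h'' <;> contradiction

/-- `σ` is a (finite valued, holomorphic) branch of `F⁻¹` on the open set `V`: it inverts
the restriction of `F` to `σ(V)`. -/
def IsBranch (F : OnePoint ℂ → OnePoint ℂ) (V : Set ℂ) (σ : ℂ → ℂ) : Prop :=
  DifferentiableOn ℂ σ V ∧ ∀ w ∈ V, F (σ w : OnePoint ℂ) = (w : OnePoint ℂ)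

/-- `V` is a connected open neighbourhood of `z` in the unit disc, `d` is the degree of `F`, and
`σ₁, …, σ_d` are `d` distinct branches of `F⁻¹` defined on `V`. -/
structure AreBranchesNear (F : OnePoint ℂ → OnePoint ℂ) (z : ℂ) (d : ℕ) (V : Set ℂ)
    (σ : Fin d → ℂ → ℂ) : Prop where
  hasDegree : HasDegree F d
  isOpen : IsOpen V
  isConnected : IsConnected V
  subset_disc : V ⊆ disc
  mem : z ∈ V
  isBranch : ∀ j, IsBranch F V (σ j)
  distinct : ∀ i j, i ≠ j → ¬ EqOn (σ i) (σ j) V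

/-! ### The operators -/

/-- `T` is the composition operator `f ↦ f ∘ φ` on `H²`. -/
def IsCompositionOperator (φ : RatFunc ℂ) (T : H2 →L[ℂ] H2) : Prop :=
  ∀ f : H2, ∀ z ∈ disc, H2.ev (T f) z = H2.ev f (value φ z)

/-- The composition operator `C_φ` on `H²`: the bounded operator characterized by
`IsCompositionOperator` (it is unique if it exists). -/
def compositionOperator (φ : RatFunc ℂ) : H2 →L[ℂ] H2 :=
  Classical.epsilon (IsCompositionOperator φ)

/-- `g` is the function `Ω_φ h` (for `h ∈ H²` with `h(0) = 0`): it is holomorphic on the unit disc,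
and at every regular value `z ≠ φₑ(0)` of `φₑ` in the disc it is
`∑ⱼ σⱼ'(z) / σⱼ(z) * h(σⱼ(z))`, where `σ₁, …, σ_d` are the distinct branches of `φₑ⁻¹`
near `z`. -/
def IsOmega (φ : RatFunc ℂ) (h : H2) (g : ℂ → ℂ) : Prop :=
  DifferentiableOn ℂ g disc ∧
  ∀ z ∈ disc, IsRegularValue (exteriorMap φ) (z : OnePoint ℂ) →
    exteriorMap φ ((0 : ℂ) : OnePoint ℂ) ≠ (z : OnePoint ℂ) →
    ∃ (d : ℕ) (V : Set ℂ) (σ : Fin d → ℂ → ℂ), AreBranchesNear (exteriorMap φ) z d V σ ∧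
      g z = ∑ j, deriv (σ j) z / σ j z * H2.ev h (σ j z)

/-- The function `Ω_φ h` on the unit disc, for `h ∈ H²` with `h(0) = 0` (it is unique on the
disc if it exists). -/
def Omega (φ : RatFunc ℂ) (h : H2) : ℂ → ℂ := Classical.epsilon (IsOmega φ h)

end

end HardyComp

open HardyComp

namespace HardyComp

/-! Let `k_a(w) = 1 / (1 - conj a * w)` be the reproducing kernel, so that `C_φ^* f (z)` is the
pairing of `C_φ k_z` with `f`. Write `φₑ = A / B` in lowest terms and put `x = 1 / conj w`. Then
`conj (φ w) = B(x) / A(x)`, and the conjugate of `C_φ k_z (w)` is `A(x) / (A(x) - z B(x))`. For a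
regular value `z` this rational function of `x` has `d` simple poles, the points `σⱼ(z)` of
`φₑ⁻¹(z)`, all in the disc. Its value at infinity is `1 / (1 - conj (φ 0) * z)` and its residues are
`z σⱼ'(z)`. As `1 / (x - s)` is the conjugate of `w k_s(w)`, and multiplication by `w` is the
adjoint of the backward shift, pairing with `f` gives the second formula
(`eval_eq_partialFractions`, `kernel_value_eq`, `ev_adjoint_eq`).

The critical values are finitely many. Hence `Ω_φ [f - f(0)]` is the quotient by `z` of the
holomorphic function `C_φ^* f(z) - f(0) / (1 - conj (φ 0) * z)`, which vanishes at `0`; this gives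
existence and the first formula (`exists_isOmega`, `ev_adjoint_eq_omega`).

Boundedness of `C_φ` is Littlewood's subordination: `|f|²` is at most the real part of a holomorphic
function `H`, and the mean of `Re (H ∘ φ)` over a circle about `0` is `Re H(φ 0)`
(`exists_ev_eq_comp`). -/

/-! ### Coefficients and point evaluations on `H²`. -/

theorem H2.norm_sq_eq_tsum (f : H2) : ‖f‖ ^ 2 = ∑' n, ‖f n‖ ^ 2 := by
  have := lp.norm_rpow_eq_tsum (p := 2) (by norm_num) f
  simpa using this

theorem H2.summable_norm_sq (f : H2) : Summable fun n => ‖f n‖ ^ 2 := by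
  have := (lp.memℓp f).summable (by norm_num)
  simpa using this

theorem H2.summable_ev (f : H2) {z : ℂ} (hz : z ∈ disc) : Summable fun n => f n * z ^ n := by
  have hz' : ‖z‖ < 1 := by simpa using hz
  refine Summable.of_norm_bounded (g := fun n => ‖f‖ * ‖z‖ ^ n)
    ((summable_geometric_of_lt_one (norm_nonneg _) hz').mul_left _) (fun n => ?_)
  rw [norm_mul, norm_pow]
  gcongr
  exact lp.norm_apply_le_norm (by norm_num) f n

theorem H2.differentiableOn_ev (f : H2) : DifferentiableOn ℂ (H2.ev f) disc := by
  have := (H2.hasFPowerSeriesOnBall f).differentiableOn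
  refine this.mono fun z hz => ?_
  rw [Metric.mem_eball, edist_zero_right]
  have hz' : ‖z‖ < 1 := by simpa using hz
  simpa [enorm_eq_nnnorm, ← NNReal.coe_lt_coe] using hz'

theorem H2.ev_zero (f : H2) : H2.ev f 0 = f 0 := by
  unfold H2.ev
  rw [tsum_eq_single 0]
  · simp
  · intro n hn
    simp [hn]

theorem H2.ext_ev {f g : H2} (h : EqOn (H2.ev f) (H2.ev g) disc) : f = g := by
  have h1 := (H2.hasFPowerSeriesOnBall f).hasFPowerSeriesAt
  have h2 := (H2.hasFPowerSeriesOnBall g).hasFPowerSeriesAt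
  have h3 := (h1.congr (h.eventuallyEq_of_mem
    (Metric.ball_mem_nhds _ one_pos))).eq_formalMultilinearSeries h2
  ext n
  have h6 := congrArg (fun p => FormalMultilinearSeries.coeff p n) h3
  simpa [FormalMultilinearSeries.coeff_ofScalars] using h6

theorem H2.ev_add (f g : H2) {z : ℂ} (hz : z ∈ disc) :
    H2.ev (f + g) z = H2.ev f z + H2.ev g z := by
  unfold H2.ev
  rw [← (H2.summable_ev f hz).tsum_add (H2.summable_ev g hz)]
  exact tsum_congr fun n => by simp [add_mul]

theorem H2.ev_smul (c : ℂ) (f : H2) (z : ℂ) : H2.ev (c • f) z = c * H2.ev f z := by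
  unfold H2.ev
  rw [← tsum_mul_left]
  exact tsum_congr fun n => by simp [mul_assoc]

theorem H2.ev_sub (f g : H2) {z : ℂ} (hz : z ∈ disc) :
    H2.ev (f - g) z = H2.ev f z - H2.ev g z := by
  have := H2.ev_add (f - g) g hz
  rw [sub_add_cancel] at this
  rw [this, add_sub_cancel_right]

theorem H2.ev_sum {ι : Type*} (s : Finset ι) (f : ι → H2) {z : ℂ} (hz : z ∈ disc) :
    H2.ev (∑ i ∈ s, f i) z = ∑ i ∈ s, H2.ev (f i) z := by
  classical
  induction s using Finset.induction_on with
  | empty => simp [H2.ev]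
  | insert i s hi ih => rw [Finset.sum_insert hi, Finset.sum_insert hi, H2.ev_add _ _ hz, ih]

/-! ### The backward shift on `H²` -/

/-- The backward shift as a map of sequences. -/
noncomputable def H2.tail (f : H2) : H2 :=
  ⟨fun n => f (n + 1), memℓp_gen (by
    simpa using (summable_nat_add_iff 1).2 (H2.summable_norm_sq f))⟩

@[simp] theorem H2.tail_apply (f : H2) (n : ℕ) : H2.tail f n = f (n + 1) := rfl

theorem H2.norm_sq_eq_add_tail (f : H2) : ‖f‖ ^ 2 = ‖f 0‖ ^ 2 + ‖H2.tail f‖ ^ 2 := by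
  rw [H2.norm_sq_eq_tsum, H2.norm_sq_eq_tsum, (H2.summable_norm_sq f).tsum_eq_zero_add]
  rfl

theorem H2.norm_tail_le (f : H2) : ‖H2.tail f‖ ≤ ‖f‖ := by
  have := H2.norm_sq_eq_add_tail f
  exact le_of_sq_le_sq (by nlinarith [sq_nonneg ‖f 0‖]) (norm_nonneg _)

theorem H2.ev_eq_add_tail (f : H2) {z : ℂ} (hz : z ∈ disc) :
    H2.ev f z = f 0 + z * H2.ev (H2.tail f) z := by
  unfold H2.ev
  rw [(H2.summable_ev f hz).tsum_eq_zero_add, ← tsum_mul_left]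
  simp only [pow_zero, mul_one, H2.tail_apply]
  congr 1
  exact tsum_congr fun n => by ring

/-- The backward shift as a contraction of `H²`. -/
noncomputable def H2.shift : H2 →L[ℂ] H2 :=
  LinearMap.mkContinuous
    { toFun := H2.tail
      map_add' := fun f g => by ext n; simp
      map_smul' := fun c f => by ext n; simp } 1 (fun f => by simpa using H2.norm_tail_le f)

theorem H2.shift_apply (f : H2) : H2.shift f = H2.tail f := rfl

/-! ### The resolvent of the backward shift and a harmonic majorant of `|f|²`. -/

theorem H2.norm_smul_shift_lt {z : ℂ} (hz : z ∈ disc) : ‖z • H2.shift‖ < 1 := by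
  have h : ‖H2.shift‖ ≤ 1 := LinearMap.mkContinuous_norm_le _ zero_le_one _
  have hz' : ‖z‖ < 1 := by simpa using hz
  rw [norm_smul]
  nlinarith [norm_nonneg z]

theorem H2.isUnit_one_sub {z : ℂ} (hz : z ∈ disc) : IsUnit (1 - z • H2.shift) :=
  (Units.oneSub _ (H2.norm_smul_shift_lt hz)).isUnit

/-- The element `(1 - z B)⁻¹ f`, where `B` is the backward shift. -/
noncomputable def H2.resolvent (f : H2) (z : ℂ) : H2 := Ring.inverse (1 - z • H2.shift) f

theorem H2.resolvent_spec (f : H2) {z : ℂ} (hz : z ∈ disc) :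
    H2.resolvent f z = f + z • H2.tail (H2.resolvent f z) := by
  have h := Ring.mul_inverse_cancel _ (H2.isUnit_one_sub hz)
  have h2 := congrArg (fun T : H2 →L[ℂ] H2 => T f) h
  have h3 : H2.resolvent f z - z • H2.tail (H2.resolvent f z) = f := h2
  rw [← sub_eq_iff_eq_add]
  exact h3

/-- For `g = f + z B g`, evaluate at `z` and compare with `g(z) = g(0) + z (B g)(z)`. -/
theorem H2.resolvent_apply_zero (f : H2) {z : ℂ} (hz : z ∈ disc) :
    H2.resolvent f z 0 = H2.ev f z := by
  have h1 := congrArg (fun g => H2.ev g z) (H2.resolvent_spec f hz)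
  simp only [H2.ev_add _ _ hz, H2.ev_smul] at h1
  have h2 := H2.ev_eq_add_tail (H2.resolvent f z) hz
  rw [h2] at h1
  exact add_right_cancel h1

/-- The holomorphic function whose real part is the Poisson integral of `|f|²`. -/
noncomputable def H2.herglotz (f : H2) (z : ℂ) : ℂ :=
  inner ℂ f (H2.resolvent f z + z • H2.tail (H2.resolvent f z))

theorem H2.differentiableOn_resolvent (f : H2) : DifferentiableOn ℂ (H2.resolvent f) disc := by
  intro z hz
  have h1 : DifferentiableAt ℂ (fun z : ℂ => (1 - z • H2.shift : H2 →L[ℂ] H2)) z := by fun_prop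
  have h2 : DifferentiableAt ℂ Ring.inverse (1 - z • H2.shift : H2 →L[ℂ] H2) :=
    differentiableAt_inverse (H2.isUnit_one_sub hz)
  exact ((h2.comp z h1).clm_apply (differentiableAt_const f)).differentiableWithinAt

theorem H2.differentiableOn_herglotz (f : H2) : DifferentiableOn ℂ (H2.herglotz f) disc := by
  have h1 := H2.differentiableOn_resolvent f
  have h2 : DifferentiableOn ℂ
      (fun z => H2.resolvent f z + z • H2.shift (H2.resolvent f z)) disc :=
    h1.add (differentiableOn_id.smul (H2.shift.differentiable.comp_differentiableOn h1))
  exact (innerSL ℂ f).differentiable.comp_differentiableOn h2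

/-- With `g = (1 - z B)⁻¹ f`, the right side is `‖g‖² - |z|² ‖B g‖² = |g(0)|² + (1 - |z|²) ‖B g‖²`,
and `g(0) = f(z)`. -/
theorem H2.norm_sq_ev_le (f : H2) {z : ℂ} (hz : z ∈ disc) :
    ‖H2.ev f z‖ ^ 2 ≤ (H2.herglotz f z).re := by
  have hz' : ‖z‖ < 1 := by simpa using hz
  set g := H2.resolvent f z with hg
  have hf : f = g - z • H2.tail g := by
    rw [eq_sub_iff_add_eq]; exact (H2.resolvent_spec f hz).symm
  have h0 : g 0 = H2.ev f z := H2.resolvent_apply_zero f hz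
  have h1 : (H2.herglotz f z).re = ‖g‖ ^ 2 - ‖z‖ ^ 2 * ‖H2.tail g‖ ^ 2 := by
    unfold H2.herglotz
    rw [← hg]
    -- Pairing `g - z B g` with `g + z B g` leaves cross terms whose real parts cancel.
    nth_rw 1 [hf]
    have h3 := inner_re_symm (𝕜 := ℂ) (z • H2.tail g) g
    simp only [RCLike.re_to_complex] at h3
    rw [inner_sub_left, inner_add_right, inner_add_right, inner_self_eq_norm_sq_to_K,
      inner_self_eq_norm_sq_to_K, norm_smul]
    simp only [Complex.sub_re, Complex.add_re, h3]
    simp only [Complex.coe_algebraMap, ← Complex.ofReal_pow, Complex.ofReal_re]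
    ring
  have h2 := H2.norm_sq_eq_add_tail g
  rw [h1, ← h0]
  have h4 : ‖z‖ ^ 2 ≤ 1 := by nlinarith [norm_nonneg z]
  nlinarith [sq_nonneg ‖H2.tail g‖, sq_nonneg ‖g 0‖]

theorem H2.norm_herglotz_le (f : H2) {z : ℂ} (hz : z ∈ disc) :
    ‖H2.herglotz f z‖ ≤ (1 + ‖z‖) / (1 - ‖z‖) * ‖f‖ ^ 2 := by
  have hz' : ‖z‖ < 1 := by simpa using hz
  set g := H2.resolvent f z with hg
  have ht := H2.norm_tail_le g
  have hn := norm_nonneg z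
  have hzt : ‖z • H2.tail g‖ ≤ ‖z‖ * ‖g‖ := by
    rw [norm_smul]; gcongr
  have h1 : ‖g‖ ≤ ‖f‖ + ‖z‖ * ‖g‖ := by
    calc ‖g‖ = ‖f + z • H2.tail g‖ := by rw [← H2.resolvent_spec f hz]
      _ ≤ _ := (norm_add_le _ _).trans (by gcongr)
  have h2 : ‖g‖ ≤ ‖f‖ / (1 - ‖z‖) := by
    rw [le_div_iff₀ (by linarith)]; linarith
  calc ‖H2.herglotz f z‖ ≤ ‖f‖ * ‖g + z • H2.tail g‖ := norm_inner_le_norm _ _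
    _ ≤ ‖f‖ * (‖g‖ + ‖z‖ * ‖g‖) := by gcongr; exact (norm_add_le _ _).trans (by gcongr)
    _ = ‖f‖ * ((1 + ‖z‖) * ‖g‖) := by ring
    _ ≤ ‖f‖ * ((1 + ‖z‖) * (‖f‖ / (1 - ‖z‖))) := by gcongr
    _ = _ := by ring

/-! ### Boundedness of composition operators -/

theorem closedBall_subset_disc {r : ℝ} (hr : r < 1) : Metric.closedBall (0 : ℂ) r ⊆ disc :=
  Metric.closedBall_subset_ball hr

theorem differentiableOn_dslope_disc {g : ℂ → ℂ} (hg : DifferentiableOn ℂ g disc) :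
    DifferentiableOn ℂ (dslope g 0) disc :=
  (Complex.differentiableOn_dslope (Metric.ball_mem_nhds _ one_pos)).2 hg

theorem circleAverage_eq_of_disc {g : ℂ → ℂ} (hg : DifferentiableOn ℂ g disc) {r : ℝ}
    (hr0 : 0 ≤ r) (hr : r < 1) : Real.circleAverage g 0 r = g 0 := by
  apply DiffContOnCl.circleAverage
  rw [abs_of_nonneg hr0]
  exact hg.diffContOnCl_ball (closedBall_subset_disc hr)

theorem circleIntegrable_of_disc {E : Type*} [NormedAddCommGroup E] {g : ℂ → E}
    (hg : ContinuousOn g disc) {r : ℝ}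
    (hr0 : 0 ≤ r) (hr : r < 1) : CircleIntegrable g 0 r :=
  (hg.mono (Metric.sphere_subset_closedBall.trans (closedBall_subset_disc hr))).circleIntegrable hr0

theorem re_circleAverage {g : ℂ → ℂ} {c : ℂ} {r : ℝ} (hg : CircleIntegrable g c r) :
    Real.circleAverage (fun z => (g z).re) c r = (Real.circleAverage g c r).re := by
  unfold Real.circleAverage
  rw [Complex.smul_re, ← Complex.reCLM_apply,
    ← Complex.reCLM.intervalIntegral_comp_comm hg]
  rfl

/-- The first step of Parseval's formula on a circle. -/
theorem circleAverage_norm_sq_eq {g : ℂ → ℂ} (hg : DifferentiableOn ℂ g disc) {r : ℝ}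
    (hr0 : 0 ≤ r) (hr : r < 1) :
    Real.circleAverage (fun z => ‖g z‖ ^ 2) 0 r =
      ‖g 0‖ ^ 2 + r ^ 2 * Real.circleAverage (fun z => ‖dslope g 0 z‖ ^ 2) 0 r := by
  set q := dslope g 0 with hq
  have hqd : DifferentiableOn ℂ q disc := differentiableOn_dslope_disc hg
  have hcd : DifferentiableOn ℂ (fun z => conj (g 0) * (z * q z)) disc :=
    (differentiableOn_const _).mul (differentiableOn_id.mul hqd)
  have h1 : EqOn (fun z => ‖g z‖ ^ 2)
      (fun z => (‖g 0‖ ^ 2 + 2 * (conj (g 0) * (z * q z)).re) + r ^ 2 * ‖q z‖ ^ 2)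
      (Metric.sphere 0 |r|) := by
    intro z hz
    have hz' : ‖z‖ = r := by simpa [abs_of_nonneg hr0] using hz
    have h2 : g z = g 0 + z * q z := by
      have := sub_smul_dslope g 0 z
      simp only [sub_zero, smul_eq_mul] at this
      rw [hq, this]; ring
    simp only
    rw [h2, ← hz', ← mul_pow, ← norm_mul, Complex.sq_norm, Complex.sq_norm, Complex.sq_norm,
      Complex.normSq_add]
    have h3 : (g 0 * conj (z * q z)).re = (conj (g 0) * (z * q z)).re := by
      rw [← Complex.conj_re]; simp
    rw [h3]; ring
  have hi1 : CircleIntegrable (fun z => 2 * (conj (g 0) * (z * q z)).re) 0 r :=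
    circleIntegrable_of_disc
      (continuousOn_const.mul (Complex.continuous_re.comp_continuousOn hcd.continuousOn)) hr0 hr
  have hi2 : CircleIntegrable (fun z => r ^ 2 * ‖q z‖ ^ 2) 0 r :=
    circleIntegrable_of_disc (by have := hqd.continuousOn; fun_prop) hr0 hr
  have hi0 : CircleIntegrable (fun _ => ‖g 0‖ ^ 2) 0 r :=
    circleIntegrable_of_disc continuousOn_const hr0 hr
  rw [Real.circleAverage_congr_sphere h1, Real.circleAverage_fun_add (hi0.fun_add hi1) hi2,
    Real.circleAverage_fun_add hi0 hi1, Real.circleAverage_const]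
  -- The cross term is the real part of a holomorphic function vanishing at `0`, so its mean is
  -- zero.
  have h4 : Real.circleAverage (fun z => 2 * (conj (g 0) * (z * q z)).re) 0 r = 0 := by
    have := Real.circleAverage_fun_smul (a := (2 : ℝ)) (c := (0 : ℂ)) (R := r)
      (f := fun z => (conj (g 0) * (z * q z)).re)
    simp only [smul_eq_mul] at this
    rw [this, re_circleAverage (circleIntegrable_of_disc hcd.continuousOn hr0 hr),
      circleAverage_eq_of_disc hcd hr0 hr]
    simp
  have h5 : Real.circleAverage (fun z => r ^ 2 * ‖q z‖ ^ 2) 0 r =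
      r ^ 2 * Real.circleAverage (fun z => ‖q z‖ ^ 2) 0 r :=
    Real.circleAverage_fun_smul (a := (r ^ 2 : ℝ)) (c := (0 : ℂ)) (R := r)
      (f := fun z => ‖q z‖ ^ 2)
  rw [h4, h5, add_zero]

/-- Bessel's inequality on the circle of radius `r`: `dslope · 0` is the backward shift on
functions, its iterates at `0` are the Taylor coefficients, and each application gains a factor `r ^
2`. -/
theorem sum_norm_sq_le_circleAverage {g : ℂ → ℂ} (hg : DifferentiableOn ℂ g disc) {r : ℝ}
    (hr0 : 0 ≤ r) (hr : r < 1) (N : ℕ) :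
    ∑ n ∈ Finset.range N, ‖((Function.swap dslope 0)^[n] g) 0‖ ^ 2 * (r ^ 2) ^ n ≤
      Real.circleAverage (fun z => ‖g z‖ ^ 2) 0 r := by
  induction N generalizing g with
  | zero =>
    simp only [Finset.range_zero, Finset.sum_empty]
    exact Real.circleAverage_nonneg_of_nonneg fun z _ => by positivity
  | succ N ih =>
    rw [circleAverage_norm_sq_eq hg hr0 hr, Finset.sum_range_succ']
    have h := ih (differentiableOn_dslope_disc hg)
    have h2 : r ^ 2 * ∑ n ∈ Finset.range N,
        ‖((Function.swap dslope 0)^[n] (dslope g 0)) 0‖ ^ 2 * (r ^ 2) ^ n ≤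
        r ^ 2 * Real.circleAverage (fun z => ‖dslope g 0 z‖ ^ 2) 0 r := by gcongr
    rw [Finset.mul_sum] at h2
    have h3 : ∀ n,
        ((Function.swap dslope 0)^[n + 1] g) = (Function.swap dslope 0)^[n] (dslope g 0) :=
      fun n => Function.iterate_succ_apply _ _ _
    simp only [h3, pow_zero, mul_one, Function.iterate_zero, id]
    have h4 : ∀ n, ‖((Function.swap dslope 0)^[n] (dslope g 0)) 0‖ ^ 2 * (r ^ 2) ^ (n + 1) =
        r ^ 2 * (‖((Function.swap dslope 0)^[n] (dslope g 0)) 0‖ ^ 2 * (r ^ 2) ^ n) :=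
      fun n => by ring
    simp only [h4]
    linarith

theorem iterate_dslope_eq_iteratedDeriv {g : ℂ → ℂ} (hg : DifferentiableOn ℂ g disc) (n : ℕ) :
    ((Function.swap dslope 0)^[n] g) 0 = iteratedDeriv n g 0 / (n.factorial : ℂ) := by
  have ha : AnalyticAt ℂ g 0 := hg.analyticAt (Metric.ball_mem_nhds _ one_pos)
  have h := ha.hasFPowerSeriesAt.has_fpower_series_iterate_dslope_fslope n
  have h1 := h.coeff_zero (fun _ => 0)
  rw [← h1]
  have h2 := FormalMultilinearSeries.coeff_iterate_fslope n 0 (p :=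
    FormalMultilinearSeries.ofScalars ℂ (fun n => iteratedDeriv n g 0 / (n.factorial : ℂ)))
  rw [FormalMultilinearSeries.coeff_ofScalars, zero_add] at h2
  rw [← h2, FormalMultilinearSeries.coeff]
  congr 1
  ext i
  exact i.elim0

/-- Littlewood's subordination principle for one function. -/
theorem exists_ev_eq_comp {ψ : ℂ → ℂ} (hψ : DifferentiableOn ℂ ψ disc) (hm : MapsTo ψ disc disc)
    (f : H2) : ∃ g : H2, EqOn (H2.ev g) (fun z => H2.ev f (ψ z)) disc ∧
      ‖g‖ ^ 2 ≤ (1 + ‖ψ 0‖) / (1 - ‖ψ 0‖) * ‖f‖ ^ 2 := by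
  set F : ℂ → ℂ := fun z => H2.ev f (ψ z) with hF
  set K := (1 + ‖ψ 0‖) / (1 - ‖ψ 0‖) * ‖f‖ ^ 2
  have h0 : (0 : ℂ) ∈ disc := by simp
  have hFd : DifferentiableOn ℂ F disc := (H2.differentiableOn_ev f).comp hψ hm
  have hH : DifferentiableOn ℂ (fun z => H2.herglotz f (ψ z)) disc :=
    (H2.differentiableOn_herglotz f).comp hψ hm
  -- The bound is uniform in `r` because the mean of the harmonic majorant is its value at the
  -- centre.
  have hav : ∀ r : ℝ, 0 ≤ r → r < 1 → Real.circleAverage (fun z => ‖F z‖ ^ 2) 0 r ≤ K := by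
    intro r hr0 hr
    calc Real.circleAverage (fun z => ‖F z‖ ^ 2) 0 r
        ≤ Real.circleAverage (fun z => (H2.herglotz f (ψ z)).re) 0 r := by
          refine Real.circleAverage_mono
            (circleIntegrable_of_disc (by have := hFd.continuousOn; fun_prop) hr0 hr)
            (circleIntegrable_of_disc (by have := hH.continuousOn; fun_prop) hr0 hr) ?_
          intro z hz
          refine H2.norm_sq_ev_le f (hm (closedBall_subset_disc hr ?_))
          rw [abs_of_nonneg hr0] at hz
          exact Metric.sphere_subset_closedBall hz
      _ = (H2.herglotz f (ψ 0)).re := by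
          rw [re_circleAverage (circleIntegrable_of_disc hH.continuousOn hr0 hr),
            circleAverage_eq_of_disc hH hr0 hr]
      _ ≤ ‖H2.herglotz f (ψ 0)‖ := Complex.re_le_norm _
      _ ≤ K := H2.norm_herglotz_le f (hm h0)
  have hpart : ∀ N, ∑ n ∈ Finset.range N, ‖iteratedDeriv n F 0 / (n.factorial : ℂ)‖ ^ 2 ≤ K := by
    -- Finite sums allow letting `r` tend to `1` from below.
    intro N
    have hc : Filter.Tendsto (fun r : ℝ => ∑ n ∈ Finset.range N,
        ‖iteratedDeriv n F 0 / (n.factorial : ℂ)‖ ^ 2 * (r ^ 2) ^ n) (nhdsWithin 1 (Iio 1))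
        (nhds (∑ n ∈ Finset.range N,
          ‖iteratedDeriv n F 0 / (n.factorial : ℂ)‖ ^ 2 * ((1 : ℝ) ^ 2) ^ n)) := by
      apply Filter.Tendsto.mono_left _ nhdsWithin_le_nhds
      exact Continuous.tendsto (by fun_prop) 1
    simp only [one_pow, mul_one] at hc
    refine le_of_tendsto hc ?_
    filter_upwards [Ioo_mem_nhdsLT (zero_lt_one' ℝ)] with r hr
    have := sum_norm_sq_le_circleAverage hFd hr.1.le hr.2 N
    simp only [iterate_dslope_eq_iteratedDeriv hFd] at this
    exact this.trans (hav r hr.1.le hr.2)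
  have hs : Summable fun n : ℕ => ‖iteratedDeriv n F 0 / (n.factorial : ℂ)‖ ^ 2 :=
    summable_of_sum_range_le (fun n => by positivity) hpart
  obtain ⟨g, hg, -⟩ := H2.existsUnique_ev_eq F hFd hs
  refine ⟨g, hg, ?_⟩
  rw [H2.norm_sq_eq_tsum]
  have hcoef : ∀ n, (g n : ℂ) = iteratedDeriv n F 0 / (n.factorial : ℂ) := by
    intro n
    have h1 := (H2.hasFPowerSeriesOnBall g).hasFPowerSeriesAt
    have h3 := h1.congr (hg.eventuallyEq_of_mem (Metric.ball_mem_nhds _ one_pos))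
    have h5 := h3.eq_formalMultilinearSeries h3.analyticAt.hasFPowerSeriesAt
    have h6 := congrArg (fun p => FormalMultilinearSeries.coeff p n) h5
    simpa [FormalMultilinearSeries.coeff_ofScalars] using h6
  simp only [hcoef]
  exact hs.tsum_le_of_sum_range_le hpart

/-- Composition with a holomorphic self-map of the disc is a bounded operator on `H²`. -/
theorem exists_composition_operator {ψ : ℂ → ℂ} (hψ : DifferentiableOn ℂ ψ disc)
    (hm : MapsTo ψ disc disc) :
    ∃ T : H2 →L[ℂ] H2, ∀ f : H2, ∀ z ∈ disc, H2.ev (T f) z = H2.ev f (ψ z) := by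
  choose T hT hb using exists_ev_eq_comp hψ hm
  have h0 : ‖ψ 0‖ < 1 := by simpa using hm (show (0 : ℂ) ∈ disc by simp)
  have hK : 0 ≤ (1 + ‖ψ 0‖) / (1 - ‖ψ 0‖) :=
    div_nonneg (by positivity) (by linarith)
  refine ⟨LinearMap.mkContinuous
    { toFun := T
      map_add' := fun f g => ?_
      map_smul' := fun c f => ?_ } (Real.sqrt ((1 + ‖ψ 0‖) / (1 - ‖ψ 0‖))) fun f => ?_, hT⟩
  · refine H2.ext_ev fun z hz => ?_
    rw [hT _ hz, H2.ev_add _ _ hz, hT _ hz, hT _ hz]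
    exact H2.ev_add _ _ (hm hz)
  · refine H2.ext_ev fun z hz => ?_
    rw [hT _ hz, RingHom.id_apply, H2.ev_smul, hT _ hz]
    exact H2.ev_smul _ _ _
  · refine le_of_sq_le_sq ?_ (by positivity)
    rw [mul_pow, Real.sq_sqrt hK]
    exact hb f

/-! ### Rational maps of the sphere -/

theorem eval_ne_zero_of_isCoprime {A B : ℂ[X]} (h : IsCoprime A B) {x : ℂ} (hA : A.eval x = 0) :
    B.eval x ≠ 0 := by
  have := (Polynomial.isCoprime_iff_aeval_ne_zero_of_isAlgClosed (k := ℂ) ℂ A B).1 h x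
  simp only [Polynomial.coe_aeval_eq_eval] at this
  exact this.resolve_left (not_not.2 hA)

theorem quotientMap_coe (A B : ℂ[X]) (x : ℂ) : quotientMap A B (x : OnePoint ℂ) =
    if B.eval x = 0 then ∞ else ((A.eval x / B.eval x : ℂ) : OnePoint ℂ) := rfl

theorem quotientMap_infty (A B : ℂ[X]) : quotientMap A B ∞ =
    if B.coeff (max A.natDegree B.natDegree) = 0 then ∞ else
      ((A.coeff (max A.natDegree B.natDegree) / B.coeff (max A.natDegree B.natDegree) : ℂ) :
        OnePoint ℂ) := rfl

theorem quotientMap_coe_eq_coe_iff {A B : ℂ[X]} (h : IsCoprime A B) (x z : ℂ) :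
    quotientMap A B (x : OnePoint ℂ) = (z : OnePoint ℂ) ↔ A.eval x = z * B.eval x := by
  rw [quotientMap_coe]
  split_ifs with hB
  · have hA : A.eval x ≠ 0 := eval_ne_zero_of_isCoprime h.symm hB
    simp [hB, hA]
  · rw [OnePoint.coe_eq_coe, div_eq_iff hB]

theorem quotientMap_coe_eq_infty_iff (A B : ℂ[X]) (x : ℂ) :
    quotientMap A B (x : OnePoint ℂ) = ∞ ↔ B.eval x = 0 := by
  rw [quotientMap_coe]
  split_ifs with hB <;> simp [hB]

theorem natDegree_eq_of_dvd_dvd {A A' : ℂ[X]} (h1 : A ∣ A') (h2 : A' ∣ A) :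
    A.natDegree = A'.natDegree :=
  natDegree_eq_of_degree_eq (degree_eq_degree_of_associated (associated_of_dvd_dvd h1 h2))

/-- Cross-multiplying gives `A B' = A' B`, and coprimality makes the numerators, and likewise the
denominators, associated. Thus the degree of a rational map does not depend on its representation.
-/
theorem natDegree_eq_of_quotientMap_eq {A B A' B' : ℂ[X]} (h : IsCoprime A B)
    (h' : IsCoprime A' B') (he : quotientMap A B = quotientMap A' B') :
    A.natDegree = A'.natDegree ∧ B.natDegree = B'.natDegree := by
  have hcross : A * B' = A' * B := by
    refine Polynomial.funext fun x => ?_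
    have hx := congrFun he (x : OnePoint ℂ)
    simp only [eval_mul]
    by_cases hB : B.eval x = 0
    · have hB' : B'.eval x = 0 := by
        rw [← quotientMap_coe_eq_infty_iff A' B', ← hx, quotientMap_coe_eq_infty_iff, hB]
      simp [hB, hB']
    · rw [quotientMap_coe, if_neg hB] at hx
      have := (quotientMap_coe_eq_coe_iff h' _ _).1 hx.symm
      rw [this]
      field_simp
  have hA1 : A ∣ A' := h.dvd_of_dvd_mul_right (hcross ▸ dvd_mul_right A B')
  have hA2 : A' ∣ A := h'.dvd_of_dvd_mul_right (hcross ▸ dvd_mul_right A' B)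
  have hB1 : B ∣ B' := h.symm.dvd_of_dvd_mul_left (hcross ▸ dvd_mul_left B A')
  have hB2 : B' ∣ B := h'.symm.dvd_of_dvd_mul_left (hcross ▸ dvd_mul_left B' A)
  exact ⟨natDegree_eq_of_dvd_dvd hA1 hA2, natDegree_eq_of_dvd_dvd hB1 hB2⟩

theorem HasDegree.unique {F : OnePoint ℂ → OnePoint ℂ} {d d' : ℕ} (h : HasDegree F d)
    (h' : HasDegree F d') : d = d' := by
  obtain ⟨A, B, hc, he, hd⟩ := h
  obtain ⟨A', B', hc', he', hd'⟩ := h'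
  obtain ⟨h1, h2⟩ := natDegree_eq_of_quotientMap_eq hc hc' (he.symm.trans he')
  rw [← hd, ← hd', h1, h2]

/-! ### The exterior map of a self-map of the disc -/

/-- The homogeneous form of `a / b = 1 / conj v`: it treats a pole and `v = 0` on the same footing
as finite values. -/
theorem eq_conj_mul_of_eq_inversion {a b v : ℂ} (hab : a = 0 → b ≠ 0)
    (h : (if b = 0 then ∞ else ((a / b : ℂ) : OnePoint ℂ)) = inversion (v : OnePoint ℂ)) :
    a ≠ 0 ∧ b = conj v * a := by
  have h2 : inversion (v : OnePoint ℂ) =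
    if v = 0 then ∞ else (((conj v)⁻¹ : ℂ) : OnePoint ℂ) := rfl
  rw [h2] at h
  split_ifs at h with hb hv hv
  · exact ⟨fun ha => hab ha hb, by simp [hb, hv]⟩
  · exact absurd h (OnePoint.infty_ne_coe _)
  · exact absurd h (OnePoint.coe_ne_infty _)
  · rw [OnePoint.coe_eq_coe] at h
    have hv' : conj v ≠ 0 := by simpa using hv
    have ha : a = b / conj v := by
      rw [eq_div_iff hv']; field_simp at h; exact h
    refine ⟨?_, ?_⟩
    · rw [ha]; exact div_ne_zero hb hv'
    · rw [ha]; field_simp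

theorem sphereMap_coe {φ : RatFunc ℂ} (hφ : φ ∈ RatU) {w : ℂ} (hw : w ∈ disc) :
    sphereMap φ (w : OnePoint ℂ) = (value φ w : OnePoint ℂ) :=
  if_neg (hφ w hw).1

theorem exteriorMap_infty {φ : RatFunc ℂ} (hφ : φ ∈ RatU) :
    exteriorMap φ ∞ = inversion (value φ 0 : OnePoint ℂ) := by
  have : inversion ∞ = ((0 : ℂ) : OnePoint ℂ) := rfl
  rw [exteriorMap, Function.comp_apply, Function.comp_apply, this, sphereMap_coe hφ (by simp)]

theorem exteriorMap_inv_conj {φ : RatFunc ℂ} (hφ : φ ∈ RatU) {w : ℂ} (hw : w ∈ disc)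
    (hw0 : w ≠ 0) :
    exteriorMap φ (((conj w)⁻¹ : ℂ) : OnePoint ℂ) = inversion (value φ w : OnePoint ℂ) := by
  have h0 : (conj w)⁻¹ ≠ 0 := by simpa using hw0
  have : inversion (((conj w)⁻¹ : ℂ) : OnePoint ℂ) = (w : OnePoint ℂ) := by
    have h1 : inversion (((conj w)⁻¹ : ℂ) : OnePoint ℂ) =
      if (conj w)⁻¹ = 0 then ∞ else (((conj ((conj w)⁻¹))⁻¹ : ℂ) : OnePoint ℂ) := rfl
    rw [h1, if_neg h0]
    simp
  rw [exteriorMap, Function.comp_apply, Function.comp_apply, this, sphereMap_coe hφ hw]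

/-- `A / B` is a reduced representation of the exterior map of `φ`, of degree `d`. -/
structure Represents (φ : RatFunc ℂ) (A B : ℂ[X]) (d : ℕ) : Prop where
  mem_RatU : φ ∈ RatU
  isCoprime : IsCoprime A B
  eq : exteriorMap φ = quotientMap A B
  degree : max A.natDegree B.natDegree = d

namespace Represents

variable {φ : RatFunc ℂ} {A B : ℂ[X]} {d : ℕ}

theorem norm_value_lt (h : Represents φ A B d) {w : ℂ} (hw : w ∈ disc) : ‖value φ w‖ < 1 := by
  simpa using (h.mem_RatU w hw).2

theorem coeff_degree (h : Represents φ A B d) :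
    A.coeff d ≠ 0 ∧ B.coeff d = conj (value φ 0) * A.coeff d := by
  have h1 := exteriorMap_infty h.mem_RatU
  rw [h.eq, quotientMap_infty, h.degree] at h1
  refine eq_conj_mul_of_eq_inversion (fun hA hB => ?_) h1
  have hdA : A.natDegree ≤ d := h.degree ▸ le_max_left _ _
  have hdB : B.natDegree ≤ d := h.degree ▸ le_max_right _ _
  -- One of the polynomials has degree `d`, so if both coefficients at `d` vanished, both
  -- polynomials would be zero, against coprimality.
  rcases max_choice A.natDegree B.natDegree with hm | hm
  · rw [h.degree] at hm
    have hA0 : A = 0 := by rw [hm] at hA; exact leadingCoeff_eq_zero.1 hA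
    have hd0 : d = 0 := by rw [hm, hA0, natDegree_zero]
    have hB0 : B = 0 := by
      rw [hd0] at hdB hB
      rw [eq_C_of_natDegree_le_zero hdB, hB, C_0]
    have := h.isCoprime
    rw [hA0, hB0] at this
    exact not_isUnit_zero (isCoprime_zero_left.1 this)
  · rw [h.degree] at hm
    have hB0 : B = 0 := by rw [hm] at hB; exact leadingCoeff_eq_zero.1 hB
    have hd0 : d = 0 := by rw [hm, hB0, natDegree_zero]
    have hA0 : A = 0 := by
      rw [hd0] at hdA hA
      rw [eq_C_of_natDegree_le_zero hdA, hA, C_0]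
    have := h.isCoprime
    rw [hA0, hB0] at this
    exact not_isUnit_zero (isCoprime_zero_left.1 this)

theorem eval_inv_conj (h : Represents φ A B d) {w : ℂ} (hw : w ∈ disc) (hw0 : w ≠ 0) :
    A.eval (conj w)⁻¹ ≠ 0 ∧
      B.eval (conj w)⁻¹ = conj (value φ w) * A.eval (conj w)⁻¹ := by
  have h1 := exteriorMap_inv_conj h.mem_RatU hw hw0
  rw [h.eq, quotientMap_coe] at h1
  exact eq_conj_mul_of_eq_inversion (fun hA => eval_ne_zero_of_isCoprime h.isCoprime hA) h1

/-- Outside the closed disc this is `|φ| < 1` transported by inversion. Points of the unit circle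
are reached radially from outside. -/
theorem norm_eval_le (h : Represents φ A B d) {y : ℂ} (hy : 1 ≤ ‖y‖) :
    ‖B.eval y‖ ≤ ‖A.eval y‖ := by
  have key : ∀ t : ℝ, 1 < t → ‖B.eval ((t : ℂ) * y)‖ ≤ ‖A.eval ((t : ℂ) * y)‖ := by
    intro t ht
    have hty : 1 < ‖(t : ℂ) * y‖ := by
      rw [norm_mul, Complex.norm_of_nonneg (by linarith)]
      nlinarith
    set x := (t : ℂ) * y
    have hx0 : x ≠ 0 := by
      intro h0; rw [h0, norm_zero] at hty; linarith
    have hw : (conj x)⁻¹ ∈ disc := by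
      simpa using inv_lt_one_of_one_lt₀ hty
    have hw0 : (conj x)⁻¹ ≠ 0 := by simpa using hx0
    have h2 := (h.eval_inv_conj hw hw0).2
    simp only [map_inv₀, Complex.conj_conj, inv_inv] at h2
    rw [h2, norm_mul, RCLike.norm_conj]
    have := (h.norm_value_lt hw).le
    exact mul_le_of_le_one_left (norm_nonneg _) this
  have hcont : ∀ P : ℂ[X], Filter.Tendsto (fun t : ℝ => ‖P.eval ((t : ℂ) * y)‖)
      (nhdsWithin 1 (Ioi 1)) (nhds ‖P.eval y‖) := by
    intro P
    have hc : Continuous fun t : ℝ => ‖P.eval ((t : ℂ) * y)‖ := by fun_prop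
    have := hc.tendsto 1
    simp only [Complex.ofReal_one, one_mul] at this
    exact this.mono_left nhdsWithin_le_nhds
  refine le_of_tendsto_of_tendsto (hcont B) (hcont A) ?_
  filter_upwards [self_mem_nhdsWithin] with t ht using key t ht

/-- The fibres of `φₑ` over the disc lie in the disc, so `f` can be evaluated on branches. Otherwise
`|A| = |z| |B| ≤ |z| |A|` at `x` with `|z| < 1`, and `A`, `B` would share a zero. -/
theorem mem_disc_of_eval_eq (h : Represents φ A B d) {x z : ℂ} (hz : z ∈ disc)
    (hx : A.eval x = z * B.eval x) : x ∈ disc := by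
  by_contra hn
  have h1 : 1 ≤ ‖x‖ := by simpa using hn
  have hz' : ‖z‖ < 1 := by simpa using hz
  have h2 := h.norm_eval_le h1
  rw [hx, norm_mul] at h2
  have h3 : ‖B.eval x‖ = 0 := by
    by_contra h4
    have : 0 < ‖B.eval x‖ := lt_of_le_of_ne (norm_nonneg _) (Ne.symm h4)
    nlinarith
  have hB : B.eval x = 0 := norm_eq_zero.1 h3
  have hA : A.eval x = 0 := by rw [hx, hB, mul_zero]
  exact eval_ne_zero_of_isCoprime h.isCoprime hA hB

theorem one_sub_ne_zero (h : Represents φ A B d) {w z : ℂ} (hw : w ∈ disc) (hz : z ∈ disc) :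
    1 - conj (value φ w) * z ≠ 0 := by
  intro h0
  have h1 : ‖conj (value φ w) * z‖ = 1 := by
    rw [← sub_eq_zero.1 h0, norm_one]
  rw [norm_mul, RCLike.norm_conj] at h1
  have hz' : ‖z‖ < 1 := by simpa using hz
  have := h.norm_value_lt hw
  nlinarith [norm_nonneg z, norm_nonneg (value φ w)]

/-! ### Fibres over the disc as root sets of `A - z B`, and regular values. -/

theorem fiber_natDegree_le (h : Represents φ A B d) (z : ℂ) :
    (A - C z * B).natDegree ≤ d := by
  refine (natDegree_sub_le _ _).trans (max_le (h.degree ▸ le_max_left _ _) ?_)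
  exact (natDegree_C_mul_le _ _).trans (h.degree ▸ le_max_right _ _)

theorem fiber_coeff (h : Represents φ A B d) (z : ℂ) :
    (A - C z * B).coeff d = (1 - conj (value φ 0) * z) * A.coeff d := by
  rw [coeff_sub, coeff_C_mul, h.coeff_degree.2]; ring

/-- This says that `∞` is not in the fibre over `z`: `φₑ(∞)` is the inversion of `φ(0)` and lies
outside the closed disc. -/
theorem fiber_coeff_ne_zero (h : Represents φ A B d) {z : ℂ} (hz : z ∈ disc) :
    (A - C z * B).coeff d ≠ 0 := by
  rw [h.fiber_coeff]
  exact mul_ne_zero (h.one_sub_ne_zero (by simp) hz) h.coeff_degree.1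

theorem fiber_natDegree (h : Represents φ A B d) {z : ℂ} (hz : z ∈ disc) :
    (A - C z * B).natDegree = d :=
  le_antisymm (h.fiber_natDegree_le z) (le_natDegree_of_ne_zero (h.fiber_coeff_ne_zero hz))

theorem fiber_ne_zero (h : Represents φ A B d) {z : ℂ} (hz : z ∈ disc) : A - C z * B ≠ 0 :=
  fun h0 => h.fiber_coeff_ne_zero hz (by rw [h0, coeff_zero])

theorem preimage_eq (h : Represents φ A B d) {z : ℂ} (hz : z ∈ disc) :
    exteriorMap φ ⁻¹' {(z : OnePoint ℂ)} =
      ((↑) : ℂ → OnePoint ℂ) '' ((A - C z * B).roots.toFinset : Set ℂ) := by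
  ext x
  rw [h.eq, mem_preimage, mem_singleton_iff]
  cases x using OnePoint.rec with
  | infty =>
    simp only [mem_image, OnePoint.coe_ne_infty, and_false, exists_false, iff_false]
    intro hc
    rw [quotientMap_infty, h.degree] at hc
    split_ifs at hc with hB
    · exact OnePoint.infty_ne_coe _ hc
    · rw [OnePoint.coe_eq_coe, div_eq_iff hB] at hc
      refine h.fiber_coeff_ne_zero hz ?_
      rw [coeff_sub, coeff_C_mul, hc, sub_self]
  | coe x =>
    rw [quotientMap_coe_eq_coe_iff h.isCoprime]
    simp [h.fiber_ne_zero hz, sub_eq_zero]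

theorem isRegularValue_iff (h : Represents φ A B d) {z : ℂ} (hz : z ∈ disc) :
    IsRegularValue (exteriorMap φ) (z : OnePoint ℂ) ↔ (A - C z * B).roots.Nodup := by
  have hd : HasDegree (exteriorMap φ) d := ⟨A, B, h.isCoprime, h.eq, h.degree⟩
  have hcard : Multiset.card (A - C z * B).roots = d := by
    rw [← h.fiber_natDegree hz]
    exact IsAlgClosed.card_roots_eq_natDegree
  have he : (exteriorMap φ ⁻¹' {(z : OnePoint ℂ)}).encard =
      ((A - C z * B).roots.toFinset.card : ℕ∞) := by
    rw [h.preimage_eq hz, OnePoint.coe_injective.encard_image, encard_coe_eq_coe_finsetCard]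
  rw [← Multiset.toFinset_card_eq_card_iff_nodup, hcard]
  constructor
  · rintro ⟨d', hd', hc⟩
    rw [← hd.unique hd', he] at hc
    exact_mod_cast hc
  · intro hc
    exact ⟨d, hd, by rw [he, hc]⟩

theorem derivative_ne_zero_of_nodup (h : Represents φ A B d) {z : ℂ} (hz : z ∈ disc)
    (hn : (A - C z * B).roots.Nodup) {x : ℂ} (hx : A.eval x = z * B.eval x) :
    (derivative (A - C z * B)).eval x ≠ 0 := by
  have h0 := h.fiber_ne_zero hz
  have hr : (A - C z * B).IsRoot x := by simp [IsRoot, hx]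
  have h1 := Multiset.nodup_iff_count_le_one.1 hn x
  rw [count_roots] at h1
  intro h2
  exact absurd ((one_lt_rootMultiplicity_iff_isRoot h0).2 ⟨hr, h2⟩) (not_lt.2 h1)

/-- At a multiple root of `A - z B` the Wronskian of `A` and `B` vanishes, and that root determines
`z`. -/
theorem finite_not_isRegularValue (h : Represents φ A B d) :
    {z ∈ disc | ¬ IsRegularValue (exteriorMap φ) (z : OnePoint ℂ)}.Finite := by
  have hsub : {z ∈ disc | ¬ IsRegularValue (exteriorMap φ) (z : OnePoint ℂ)} ⊆
      (fun x => A.eval x / B.eval x) '' ((wronskian A B).roots.toFinset : Set ℂ) := by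
    rintro z ⟨hz, hr⟩
    rw [h.isRegularValue_iff hz, Multiset.nodup_iff_count_le_one] at hr
    push Not at hr
    obtain ⟨x, hx⟩ := hr
    rw [count_roots, one_lt_rootMultiplicity_iff_isRoot (h.fiber_ne_zero hz)] at hx
    obtain ⟨h1, h2⟩ := hx
    have hx1 : A.eval x = z * B.eval x := by simpa [IsRoot, sub_eq_zero] using h1
    have hx2 : (derivative A).eval x = z * (derivative B).eval x := by
      simpa [IsRoot, sub_eq_zero] using h2
    have hB : B.eval x ≠ 0 := fun hB =>
      eval_ne_zero_of_isCoprime h.isCoprime (by rw [hx1, hB, mul_zero]) hB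
    refine ⟨x, ?_, by simp only; rw [hx1]; field_simp⟩
    -- A zero Wronskian of coprime polynomials forces `d = 0`; the fibre polynomial is then a
    -- nonzero constant and has no root.
    have hw0 : wronskian A B ≠ 0 := by
      intro hw
      obtain ⟨hA', hB'⟩ := h.isCoprime.wronskian_eq_zero_iff.1 hw
      have hA0 := derivative_eq_zero.1 hA'
      have hB0 := derivative_eq_zero.1 hB'
      have hd : d = 0 := by rw [← h.degree, hA0, hB0, max_self]
      have hc := h.fiber_natDegree hz
      have hc2 := h.fiber_coeff_ne_zero hz
      rw [hd] at hc hc2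
      rw [IsRoot, eq_C_of_natDegree_eq_zero hc, eval_C] at h1
      exact hc2 h1
    rw [Finset.mem_coe, Multiset.mem_toFinset, mem_roots hw0]
    simp only [IsRoot, wronskian, eval_sub, eval_mul, hx1, hx2]
    ring
  exact ((Finset.finite_toSet _).image _).subset hsub

theorem eventually_isRegularValue (h : Represents φ A B d) {z : ℂ} (hz : z ∈ disc) :
    ∀ᶠ v in nhdsWithin z {z}ᶜ, v ∈ disc ∧ IsRegularValue (exteriorMap φ) (v : OnePoint ℂ) := by
  have h1 : ∀ᶠ v in nhdsWithin z {z}ᶜ, v ∈ disc :=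
    nhdsWithin_le_nhds (Metric.isOpen_ball.mem_nhds hz)
  -- The point `z` is removed from the exceptional set, as it may itself fail to be regular.
  have h2 := (h.finite_not_isRegularValue.sdiff (t := {z})).isClosed.isOpen_compl.mem_nhds
    (x := z) (by simp)
  filter_upwards [h1, nhdsWithin_le_nhds h2, self_mem_nhdsWithin] with v hv1 hv2 hv3
  refine ⟨hv1, ?_⟩
  by_contra hc
  exact hv2 ⟨⟨hv1, hc⟩, hv3⟩

/-! ### Branches -/

theorem eval_branch (h : Represents φ A B d) {V : Set ℂ} {σ : ℂ → ℂ}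
    (hσ : IsBranch (exteriorMap φ) V σ) {v : ℂ} (hv : v ∈ V) :
    A.eval (σ v) = v * B.eval (σ v) := by
  have := hσ.2 v hv
  rwa [h.eq, quotientMap_coe_eq_coe_iff h.isCoprime] at this

theorem eval_denom_ne_zero (h : Represents φ A B d) {x z : ℂ} (hx : A.eval x = z * B.eval x) :
    B.eval x ≠ 0 := fun hB =>
  eval_ne_zero_of_isCoprime h.isCoprime (by rw [hx, hB, mul_zero]) hB

/-- The exterior map has a nonzero derivative at the points over a regular value. -/
theorem hasStrictDerivAt (h : Represents φ A B d) {z : ℂ} (hz : z ∈ disc)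
    (hn : (A - C z * B).roots.Nodup) {x : ℂ} (hx : A.eval x = z * B.eval x) :
    ∃ c : ℂ, c ≠ 0 ∧ HasStrictDerivAt (fun y => A.eval y / B.eval y) c x := by
  have hB := h.eval_denom_ne_zero hx
  refine ⟨_, ?_, (A.hasStrictDerivAt x).div (B.hasStrictDerivAt x) hB⟩
  have := h.derivative_ne_zero_of_nodup hz hn hx
  simp only [derivative_sub, derivative_C_mul, eval_sub, eval_mul, eval_C] at this
  rw [hx]
  have h2 : eval x (derivative A) * eval x B - z * eval x B * eval x (derivative B) =
      (eval x (derivative A) - z * eval x (derivative B)) * eval x B := by ring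
  rw [h2]
  exact div_ne_zero (mul_ne_zero this hB) (pow_ne_zero _ hB)

/-- The inverse function theorem. The last clause gives local uniqueness: a branch continuous at `z`
with value `x` there agrees with `τ` near `z`. -/
theorem exists_local_branch (h : Represents φ A B d) {z : ℂ} (hz : z ∈ disc)
    (hn : (A - C z * B).roots.Nodup) {x : ℂ} (hx : A.eval x = z * B.eval x) :
    ∃ τ : ℂ → ℂ, τ z = x ∧ (∀ᶠ v in nhds z, DifferentiableAt ℂ τ v) ∧
      (∀ᶠ v in nhds z, exteriorMap φ (τ v : OnePoint ℂ) = (v : OnePoint ℂ)) ∧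
      ∀ᶠ y in nhds x, τ (A.eval y / B.eval y) = y := by
  obtain ⟨c, hc, hs⟩ := h.hasStrictDerivAt hz hn hx
  have hB := h.eval_denom_ne_zero hx
  have hfx : A.eval x / B.eval x = z := by rw [hx]; field_simp
  set f : ℂ → ℂ := fun y => A.eval y / B.eval y with hf
  have hfx' : f x = z := hfx
  have hcd : ContDiffAt ℂ 1 f x := by
    have hA : ContDiffAt ℂ 1 (fun y => A.eval y) x := by
      simpa using (A.contDiff_aeval (𝕜 := ℂ) 1).contDiffAt (x := x)
    have hB' : ContDiffAt ℂ 1 (fun y => B.eval y) x := by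
      simpa using (B.contDiff_aeval (𝕜 := ℂ) 1).contDiffAt (x := x)
    exact hA.div hB' hB
  have hs' : HasStrictFDerivAt f
      ((ContinuousLinearEquiv.unitsEquivAut ℂ (Units.mk0 c hc) : ℂ ≃L[ℂ] ℂ) : ℂ →L[ℂ] ℂ) x :=
    hs.hasStrictFDerivAt_equiv hc
  have hinv := hcd.to_localInverse hs'.hasFDerivAt one_ne_zero
  set τ := hcd.localInverse hs'.hasFDerivAt one_ne_zero with hτ
  have hleft : ∀ᶠ y in nhds x, τ (f y) = y :=
    HasStrictFDerivAt.eventually_left_inverse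
      (hcd.hasStrictFDerivAt' hs'.hasFDerivAt one_ne_zero)
  have hright : ∀ᶠ y in nhds (f x), f (τ y) = y :=
    HasStrictFDerivAt.eventually_right_inverse
      (hcd.hasStrictFDerivAt' hs'.hasFDerivAt one_ne_zero)
  have hτz : τ z = x := by rw [← hfx']; exact hleft.self_of_nhds
  rw [hfx'] at hright hinv
  refine ⟨τ, hτz, ?_, ?_, hleft⟩
  · filter_upwards [hinv.eventually (by simp)] with v hv
    exact hv.differentiableAt one_ne_zero
  · have hBτ : ∀ᶠ v in nhds z, B.eval (τ v) ≠ 0 := by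
      have : ContinuousAt (fun v => B.eval (τ v)) z :=
        B.continuous.continuousAt.comp hinv.continuousAt
      exact this.eventually_ne (by rw [hτz]; exact hB)
    filter_upwards [hright, hBτ] with v hv hb
    rw [h.eq, quotientMap_coe_eq_coe_iff h.isCoprime, ← div_eq_iff hb]
    exact hv

theorem exists_areBranchesNear (h : Represents φ A B d) {z : ℂ} (hz : z ∈ disc)
    (hr : IsRegularValue (exteriorMap φ) (z : OnePoint ℂ)) :
    ∃ (V : Set ℂ) (σ : Fin d → ℂ → ℂ), AreBranchesNear (exteriorMap φ) z d V σ := by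
  have hn := (h.isRegularValue_iff hz).1 hr
  have hcard : (A - C z * B).roots.toFinset.card = d := by
    rw [Multiset.toFinset_card_of_nodup hn, ← h.fiber_natDegree hz]
    exact IsAlgClosed.card_roots_eq_natDegree
  let e := (Finset.equivFinOfCardEq hcard).symm
  have hroot : ∀ j, A.eval (e j : ℂ) = z * B.eval (e j : ℂ) := by
    intro j
    have := (e j).2
    rw [Multiset.mem_toFinset, mem_roots (h.fiber_ne_zero hz)] at this
    simpa [IsRoot, sub_eq_zero] using this
  choose σ hσz hσd hσe _ using fun j => h.exists_local_branch hz hn (hroot j)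
  have hev : ∀ᶠ v in nhds z, v ∈ disc ∧ ∀ j, DifferentiableAt ℂ (σ j) v ∧
      exteriorMap φ (σ j v : OnePoint ℂ) = (v : OnePoint ℂ) := by
    have h1 : ∀ᶠ v in nhds z, v ∈ disc := Metric.isOpen_ball.eventually_mem hz
    exact h1.and (Filter.eventually_all.2 fun j => (hσd j).and (hσe j))
  obtain ⟨ε, hε, hball⟩ := Metric.eventually_nhds_iff_ball.1 hev
  refine ⟨Metric.ball z ε, σ, ⟨A, B, h.isCoprime, h.eq, h.degree⟩, Metric.isOpen_ball,
    (convex_ball z ε).isConnected ⟨z, Metric.mem_ball_self hε⟩, fun v hv => (hball v hv).1,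
    Metric.mem_ball_self hε, fun j => ⟨fun v hv => ((hball v hv).2 j).1.differentiableWithinAt,
      fun v hv => ((hball v hv).2 j).2⟩, fun i j hij he => hij ?_⟩
  have := he (Metric.mem_ball_self hε)
  rw [hσz, hσz] at this
  exact e.injective (Subtype.ext this)

/-- Distinct branches have distinct values at a regular value. -/
theorem branch_injective (h : Represents φ A B d) {z : ℂ} {V : Set ℂ} {n : ℕ}
    {σ : Fin n → ℂ → ℂ} (hσ : AreBranchesNear (exteriorMap φ) z n V σ)
    (hr : IsRegularValue (exteriorMap φ) (z : OnePoint ℂ)) :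
    Function.Injective fun j => σ j z := by
  intro i j hij
  by_contra hne
  have hz := hσ.subset_disc hσ.mem
  have hn := (h.isRegularValue_iff hz).1 hr
  obtain ⟨τ, -, -, -, hτ⟩ :=
    h.exists_local_branch hz hn (h.eval_branch (hσ.isBranch i) hσ.mem)
  have hV : V ∈ nhds z := hσ.isOpen.mem_nhds hσ.mem
  have hloc : ∀ k, σ k z = σ i z → ∀ᶠ v in nhds z, σ k v = τ v := by
    intro k hk
    have hc : ContinuousAt (σ k) z :=
      ((hσ.isBranch k).1.differentiableAt hV).continuousAt
    have h1 : ∀ᶠ v in nhds z, τ (A.eval (σ k v) / B.eval (σ k v)) = σ k v := by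
      rw [ContinuousAt, hk] at hc
      exact hc.eventually hτ
    filter_upwards [h1, hV] with v hv1 hv2
    have h2 := h.eval_branch (hσ.isBranch k) hv2
    rw [h2, mul_div_cancel_right₀ _ (h.eval_denom_ne_zero h2)] at hv1
    exact hv1.symm
  refine hσ.distinct i j hne ?_
  -- Both branches equal `τ` near `z`, so the identity theorem makes them equal on the connected set
  -- `V`.
  refine AnalyticOnNhd.eqOn_of_preconnected_of_eventuallyEq
    ((hσ.isBranch i).1.analyticOnNhd hσ.isOpen) ((hσ.isBranch j).1.analyticOnNhd hσ.isOpen)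
    hσ.isConnected.isPreconnected hσ.mem ?_
  filter_upwards [hloc i rfl, hloc j hij.symm] with v h1 h2
  rw [h1, h2]

/-- Differentiate `A(σ v) = v B(σ v)`. This identifies the residues of the partial fractions with `z
σⱼ'(z)`. -/
theorem deriv_branch (h : Represents φ A B d) {z : ℂ} {V : Set ℂ} (hV : IsOpen V) (hz : z ∈ V)
    {σ : ℂ → ℂ} (hσ : IsBranch (exteriorMap φ) V σ) :
    (derivative (A - C z * B)).eval (σ z) * deriv σ z = B.eval (σ z) := by
  have hd : HasDerivAt σ (deriv σ z) z :=
    (hσ.1.differentiableAt (hV.mem_nhds hz)).hasDerivAt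
  have h1 : HasDerivAt (fun v => A.eval (σ v)) ((derivative A).eval (σ z) * deriv σ z) z :=
    (A.hasDerivAt (σ z)).comp z hd
  have h2 : HasDerivAt (fun v => v * B.eval (σ v))
      (1 * B.eval (σ z) + z * ((derivative B).eval (σ z) * deriv σ z)) z :=
    (hasDerivAt_id z).mul ((B.hasDerivAt (σ z)).comp z hd)
  have h3 : (fun v => A.eval (σ v)) =ᶠ[nhds z] fun v => v * B.eval (σ v) := by
    filter_upwards [hV.mem_nhds hz] with v hv using h.eval_branch hσ hv
  have h4 := h1.unique (h2.congr_of_eventuallyEq h3)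
  simp only [derivative_sub, derivative_C_mul, eval_sub, eval_mul, eval_C]
  linear_combination h4

end Represents

/-! ### Reproducing kernels -/

theorem norm_lt_one_of_mem_disc {z : ℂ} (hz : z ∈ disc) : ‖z‖ < 1 := by simpa using hz

/-- The reproducing kernel of `H²` at the point `a` of the disc. -/
noncomputable def H2.kernel (a : ℂ) (ha : a ∈ disc) : H2 :=
  ⟨fun n => conj a ^ n, memℓp_gen (by
    have h1 : ‖a‖ ^ 2 < 1 := by
      have := norm_lt_one_of_mem_disc ha
      nlinarith [norm_nonneg a]
    refine (summable_geometric_of_lt_one (sq_nonneg ‖a‖) h1).congr fun n => ?_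
    simp [← pow_mul, mul_comm])⟩

theorem H2.kernel_apply {a : ℂ} (ha : a ∈ disc) (n : ℕ) : H2.kernel a ha n = conj a ^ n := rfl

theorem H2.inner_kernel {a : ℂ} (ha : a ∈ disc) (f : H2) :
    inner ℂ (H2.kernel a ha) f = H2.ev f a := by
  rw [lp.inner_eq_tsum, H2.ev]
  refine tsum_congr fun n => ?_
  simp [H2.kernel_apply]

theorem H2.ev_kernel {a : ℂ} (ha : a ∈ disc) {w : ℂ} (hw : w ∈ disc) :
    H2.ev (H2.kernel a ha) w = (1 - conj a * w)⁻¹ := by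
  rw [H2.ev]
  simp only [H2.kernel_apply, ← mul_pow]
  refine tsum_geometric_of_norm_lt_one ?_
  rw [norm_mul, RCLike.norm_conj]
  have := norm_lt_one_of_mem_disc ha
  have := norm_lt_one_of_mem_disc hw
  nlinarith [norm_nonneg a, norm_nonneg w]

theorem H2.tail_kernel {a : ℂ} (ha : a ∈ disc) :
    H2.tail (H2.kernel a ha) = conj a • H2.kernel a ha := by
  ext n
  simp [H2.kernel_apply, pow_succ']

/-- Kernels are eigenvectors of the backward shift, so its adjoint is multiplication by the
variable. -/
theorem H2.ev_adjoint_shift (g : H2) {w : ℂ} (hw : w ∈ disc) :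
    H2.ev (ContinuousLinearMap.adjoint H2.shift g) w = w * H2.ev g w := by
  rw [← H2.inner_kernel hw, ContinuousLinearMap.adjoint_inner_right, H2.shift_apply,
    H2.tail_kernel, inner_smul_left, H2.inner_kernel, Complex.conj_conj]

theorem H2.inner_const (c : ℂ) (f : H2) : inner ℂ (H2.const c) f = conj c * H2.ev f 0 := by
  rw [H2.const, lp.inner_single_left, H2.ev_zero]
  simp [mul_comm]

theorem H2.backwardShift_ev (f : H2) {a : ℂ} (ha : a ∈ disc) :
    backwardShift (H2.ev f) a = H2.ev (H2.tail f) a := by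
  unfold backwardShift
  split_ifs with h0
  · subst h0
    have ht : HasDerivAt (H2.ev (H2.tail f)) (deriv (H2.ev (H2.tail f)) 0) 0 :=
      ((H2.differentiableOn_ev _).differentiableAt (Metric.isOpen_ball.mem_nhds ha)).hasDerivAt
    have h1 := ((hasDerivAt_id' (0 : ℂ)).mul ht).const_add (f 0)
    have h2 : H2.ev f =ᶠ[nhds 0] fun z => f 0 + z * H2.ev (H2.tail f) z := by
      filter_upwards [Metric.isOpen_ball.mem_nhds ha] with z hz using H2.ev_eq_add_tail f hz
    rw [(h1.congr_of_eventuallyEq h2).deriv]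
    simp
  · rw [H2.ev_eq_add_tail f ha, H2.ev_zero, add_sub_cancel_left, mul_div_cancel_left₀ _ h0]

namespace Represents

variable {φ : RatFunc ℂ} {A B : ℂ[X]} {d : ℕ}

/-! ### Partial fractions -/

/-- The leading terms cancel, so the difference has degree below `d` and vanishes at the `d` nodes.
-/
theorem fiber_eq_nodal (h : Represents φ A B d) {z : ℂ} {s : Fin d → ℂ}
    (hs : Function.Injective s) (hroot : ∀ j, A.eval (s j) = z * B.eval (s j)) :
    A - C z * B = C ((A - C z * B).coeff d) * Lagrange.nodal Finset.univ s := by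
  refine Polynomial.eq_of_degree_sub_lt_of_eval_index_eq (s := Finset.univ) (v := s) hs.injOn ?_ ?_
  · rw [Finset.card_univ, Fintype.card_fin, degree_lt_iff_coeff_zero]
    intro m hm
    have hnd : (Lagrange.nodal Finset.univ s).natDegree = d := by
      rw [Lagrange.natDegree_nodal, Finset.card_univ, Fintype.card_fin]
    rw [coeff_sub (A - C z * B), coeff_C_mul]
    rcases hm.eq_or_lt with rfl | hlt
    · have hmon := (Lagrange.nodal_monic (s := Finset.univ) (v := s)).coeff_natDegree
      rw [hnd] at hmon
      rw [hmon, mul_one, sub_self]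
    · rw [coeff_eq_zero_of_natDegree_lt (p := A - C z * B) ((h.fiber_natDegree_le z).trans_lt hlt),
        coeff_eq_zero_of_natDegree_lt (p := Lagrange.nodal Finset.univ s) (hnd.trans_lt hlt),
        mul_zero, sub_zero]
  · intro j _
    rw [eval_mul, Lagrange.eval_nodal_at_node (Finset.mem_univ j), mul_zero]
    simp [hroot j]

/-- Partial fractions of `A / D` with `D = A - z B`, multiplied through by `D`. The constant `c` is
the value at infinity; `A - c D` has degree below `d` and takes the values `z B(sⱼ)` at the nodes,
so Lagrange interpolation in barycentric form applies, with weights proportional to `1 / D'(sⱼ)`. -/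
theorem eval_eq_partialFractions (h : Represents φ A B d) {z : ℂ} (hz : z ∈ disc)
    {s : Fin d → ℂ} (hs : Function.Injective s) (hroot : ∀ j, A.eval (s j) = z * B.eval (s j))
    {x : ℂ} (hx : ∀ j, x ≠ s j) :
    A.eval x = (A - C z * B).eval x * ((1 - conj (value φ 0) * z)⁻¹ +
      z * ∑ j, B.eval (s j) / (derivative (A - C z * B)).eval (s j) * (x - s j)⁻¹) := by
  set D := A - C z * B with hD
  set L := D.coeff d with hL
  have hL0 : L ≠ 0 := h.fiber_coeff_ne_zero hz
  have hc : (1 - conj (value φ 0) * z)⁻¹ * L = A.coeff d := by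
    rw [hL, hD, h.fiber_coeff, ← mul_assoc, inv_mul_cancel₀, one_mul]
    exact h.one_sub_ne_zero (by simp) hz
  set c := (1 - conj (value φ 0) * z)⁻¹
  have hnodal : D = C L * Lagrange.nodal Finset.univ s := h.fiber_eq_nodal hs hroot
  have hdeg : (A - C c * D).degree < (Finset.univ : Finset (Fin d)).card := by
    rw [Finset.card_univ, Fintype.card_fin, degree_lt_iff_coeff_zero]
    intro m hm
    rw [coeff_sub, coeff_C_mul]
    rcases hm.eq_or_lt with rfl | hlt
    · rw [← hL, hc, sub_self]
    · rw [coeff_eq_zero_of_natDegree_lt ((h.fiber_natDegree_le z).trans_lt hlt),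
        coeff_eq_zero_of_natDegree_lt (lt_of_le_of_lt (h.degree ▸ le_max_left _ _) hlt),
        mul_zero, sub_zero]
  have hint := Lagrange.eq_interpolate_of_eval_eq (fun j => z * B.eval (s j)) hs.injOn hdeg
    (fun j _ => by simp [hD, hroot j])
  have hev := Lagrange.eval_interpolate_not_at_node (s := Finset.univ) (v := s)
    (fun j => z * B.eval (s j)) (x := x) (fun j _ => hx j)
  rw [← hint] at hev
  have hw : ∀ j, Lagrange.nodalWeight Finset.univ s j =
      L * ((derivative D).eval (s j))⁻¹ := by
    intro j
    rw [Lagrange.nodalWeight_eq_eval_derivative_nodal (Finset.mem_univ j), hnodal,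
      derivative_C_mul, eval_mul, eval_C, mul_inv, ← mul_assoc, mul_inv_cancel₀ hL0, one_mul]
  have hDx : D.eval x = L * (Lagrange.nodal Finset.univ s).eval x := by
    rw [hnodal, eval_mul, eval_C]
  rw [eval_sub, eval_mul, eval_C, sub_eq_iff_eq_add] at hev
  rw [hev, mul_add, add_comm, mul_comm c]
  congr 1
  rw [hDx, Finset.mul_sum, Finset.mul_sum, Finset.mul_sum]
  refine Finset.sum_congr rfl fun j _ => ?_
  rw [hw]
  ring

theorem kernel_value_eq (h : Represents φ A B d) {z : ℂ} (hz : z ∈ disc) {s : Fin d → ℂ}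
    (hs : Function.Injective s) (hroot : ∀ j, A.eval (s j) = z * B.eval (s j)) {w : ℂ}
    (hw : w ∈ disc) :
    (1 - conj (value φ w) * z)⁻¹ = (1 - conj (value φ 0) * z)⁻¹ +
      z * ∑ j, B.eval (s j) / (derivative (A - C z * B)).eval (s j) *
        (conj w * (1 - s j * conj w)⁻¹) := by
  -- At `w = 0` the point `x = 1 / conj w` is infinity, where only the constant term survives.
  by_cases hw0 : w = 0
  · simp [hw0]
  have hcw : conj w ≠ 0 := by simpa using hw0
  obtain ⟨hA, hB⟩ := h.eval_inv_conj hw hw0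
  have hx : ∀ j, (conj w)⁻¹ ≠ s j := by
    intro j hj
    have h1 := norm_lt_one_of_mem_disc (h.mem_disc_of_eval_eq hz (hroot j))
    rw [← hj, norm_inv, RCLike.norm_conj] at h1
    have h2 := one_lt_inv₀ (norm_pos_iff.2 hw0) |>.2 (norm_lt_one_of_mem_disc hw)
    linarith
  have h1 := h.eval_eq_partialFractions hz hs hroot hx
  have h2 : (A - C z * B).eval (conj w)⁻¹ =
      A.eval (conj w)⁻¹ * (1 - conj (value φ w) * z) := by
    rw [eval_sub, eval_mul, eval_C, hB]; ring
  have h3 : ∀ j, ((conj w)⁻¹ - s j)⁻¹ = conj w * (1 - s j * conj w)⁻¹ := by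
    intro j
    rw [← mul_inv_cancel_left₀ hcw ((conj w)⁻¹ - s j)⁻¹, ← mul_inv, mul_sub,
      mul_inv_cancel₀ hcw, mul_comm (conj w) (s j)]
  simp only [h3] at h1
  rw [h2, mul_assoc] at h1
  exact inv_eq_of_mul_eq_one_right (mul_left_cancel₀ hA (by rw [mul_one]; exact h1.symm))

/-! ### The adjoint of the composition operator -/

theorem ev_adjoint_eq (h : Represents φ A B d) {T : H2 →L[ℂ] H2}
    (hT : IsCompositionOperator φ T) {z : ℂ} {n : ℕ} {V : Set ℂ} {σ : Fin n → ℂ → ℂ}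
    (hσ : AreBranchesNear (exteriorMap φ) z n V σ)
    (hr : IsRegularValue (exteriorMap φ) (z : OnePoint ℂ)) (f : H2) :
    H2.ev (ContinuousLinearMap.adjoint T f) z =
      H2.ev f 0 / (1 - conj (value φ 0) * z) +
        z * ∑ j, deriv (σ j) z * backwardShift (H2.ev f) (σ j z) := by
  obtain rfl : d = n := HasDegree.unique ⟨A, B, h.isCoprime, h.eq, h.degree⟩ hσ.hasDegree
  have hz := hσ.subset_disc hσ.mem
  have hn := (h.isRegularValue_iff hz).1 hr
  have hroot : ∀ j, A.eval (σ j z) = z * B.eval (σ j z) :=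
    fun j => h.eval_branch (hσ.isBranch j) hσ.mem
  have hs : ∀ j, σ j z ∈ disc := fun j => h.mem_disc_of_eval_eq hz (hroot j)
  have hderiv : ∀ j, B.eval (σ j z) / (derivative (A - C z * B)).eval (σ j z) =
      deriv (σ j) z := by
    intro j
    rw [div_eq_iff (h.derivative_ne_zero_of_nodup hz hn (hroot j)), mul_comm]
    exact (h.deriv_branch hσ.isOpen hσ.mem (hσ.isBranch j)).symm
  -- The conjugated partial fractions, read as an identity in `H²`; the summands are multiples of `w
  -- k_s(w)` with `s = σⱼ(z)`.
  have hTk : T (H2.kernel z hz) = H2.const (1 - conj z * value φ 0)⁻¹ +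
      ∑ j, (conj z * conj (deriv (σ j) z)) •
        ContinuousLinearMap.adjoint H2.shift (H2.kernel (σ j z) (hs j)) := by
    refine H2.ext_ev fun w hw => ?_
    have h1 := h.kernel_value_eq hz (h.branch_injective hσ hr) hroot hw
    simp only [hderiv] at h1
    replace h1 := congrArg (starRingEnd ℂ) h1
    simp only [map_inv₀, map_sub, map_one, map_mul, Complex.conj_conj, map_add,
      map_sum] at h1
    rw [hT _ w hw, H2.ev_kernel hz (h.mem_RatU w hw).2, H2.ev_add _ _ hw, H2.ev_const,
      H2.ev_sum _ _ hw, mul_comm (conj z), h1, mul_comm (conj z) (value φ 0), Finset.mul_sum]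
    congr 1
    refine Finset.sum_congr rfl fun j _ => ?_
    rw [H2.ev_smul, H2.ev_adjoint_shift _ hw, H2.ev_kernel (hs j) hw]
    ring
  rw [← H2.inner_kernel hz, ContinuousLinearMap.adjoint_inner_right, hTk, inner_add_left,
    H2.inner_const, sum_inner, Finset.mul_sum]
  congr 1
  · simp only [map_inv₀, map_sub, map_one, map_mul, Complex.conj_conj]
    rw [mul_comm z, div_eq_inv_mul]
  · refine Finset.sum_congr rfl fun j _ => ?_
    rw [inner_smul_left, ContinuousLinearMap.adjoint_inner_left, H2.inner_kernel, H2.shift_apply,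
      H2.backwardShift_ev f (hs j)]
    simp only [map_mul, Complex.conj_conj]
    ring

/-- The kernel at `0` is the constant `1`, fixed by composition. This also covers the case where `0`
is not a regular value. -/
theorem ev_adjoint_zero (h : Represents φ A B d) {T : H2 →L[ℂ] H2}
    (hT : IsCompositionOperator φ T) (f : H2) :
    H2.ev (ContinuousLinearMap.adjoint T f) 0 = H2.ev f 0 := by
  have h0 : (0 : ℂ) ∈ disc := by simp
  have hk : T (H2.kernel 0 h0) = H2.kernel 0 h0 := by
    refine H2.ext_ev fun w hw => ?_
    rw [hT _ w hw, H2.ev_kernel h0 (h.mem_RatU w hw).2, H2.ev_kernel h0 hw]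
    simp
  rw [← H2.inner_kernel h0, ContinuousLinearMap.adjoint_inner_right, hk, H2.inner_kernel]

/-- The condition `z ≠ φₑ(0)` keeps `0` out of the fibre, so division by `x` is legitimate. -/
theorem backwardShift_branch (h : Represents φ A B d) {z : ℂ} (hz : z ∈ disc) {x : ℂ}
    (hx : A.eval x = z * B.eval x)
    (hz0 : exteriorMap φ ((0 : ℂ) : OnePoint ℂ) ≠ (z : OnePoint ℂ)) (f : H2) :
    backwardShift (H2.ev f) x = H2.ev (f - H2.const (H2.ev f 0)) x / x := by
  have hx0 : x ≠ 0 := by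
    rintro rfl
    rw [h.eq] at hz0
    exact hz0 ((quotientMap_coe_eq_coe_iff h.isCoprime _ _).2 hx)
  rw [backwardShift, if_neg hx0, H2.ev_sub _ _ (h.mem_disc_of_eval_eq hz hx), H2.ev_const]

theorem sum_branches_eq (h : Represents φ A B d) {z : ℂ} {n : ℕ} {V : Set ℂ} {σ : Fin n → ℂ → ℂ}
    (hσ : AreBranchesNear (exteriorMap φ) z n V σ)
    (hz0 : exteriorMap φ ((0 : ℂ) : OnePoint ℂ) ≠ (z : OnePoint ℂ)) (f : H2) :
    ∑ j, deriv (σ j) z / σ j z * H2.ev (f - H2.const (H2.ev f 0)) (σ j z) =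
      ∑ j, deriv (σ j) z * backwardShift (H2.ev f) (σ j z) := by
  refine Finset.sum_congr rfl fun j _ => ?_
  rw [h.backwardShift_branch (hσ.subset_disc hσ.mem)
    (h.eval_branch (hσ.isBranch j) hσ.mem) hz0]
  ring

theorem continuousAt_sum_branches (h : Represents φ A B d) {z : ℂ} {n : ℕ} {V : Set ℂ}
    {σ : Fin n → ℂ → ℂ} (hσ : AreBranchesNear (exteriorMap φ) z n V σ) (f : H2) :
    ContinuousAt (fun v => ∑ j, deriv (σ j) v * backwardShift (H2.ev f) (σ j v)) z := by
  have hV : V ∈ nhds z := hσ.isOpen.mem_nhds hσ.mem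
  have hc : ContinuousAt (fun v => ∑ j, deriv (σ j) v * H2.ev (H2.tail f) (σ j v)) z := by
    refine tendsto_finsetSum _ fun j _ => ContinuousAt.mul ?_ ?_
    · exact (((hσ.isBranch j).1.deriv hσ.isOpen).differentiableAt hV).continuousAt
    · have h1 : ContinuousAt (σ j) z := ((hσ.isBranch j).1.differentiableAt hV).continuousAt
      have h2 : ContinuousAt (H2.ev (H2.tail f)) (σ j z) :=
        ((H2.differentiableOn_ev _).differentiableAt (Metric.isOpen_ball.mem_nhds
          (h.mem_disc_of_eval_eq (hσ.subset_disc hσ.mem)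
            (h.eval_branch (hσ.isBranch j) hσ.mem)))).continuousAt
      exact ContinuousAt.comp (f := σ j) h2 h1
  refine hc.congr ?_
  filter_upwards [hV] with v hv
  refine Finset.sum_congr rfl fun j _ => ?_
  rw [H2.backwardShift_ev f (h.mem_disc_of_eval_eq (hσ.subset_disc hv)
    (h.eval_branch (hσ.isBranch j) hv))]

theorem differentiableOn_adjoint_sub (h : Represents φ A B d) (T : H2 →L[ℂ] H2) (f : H2) :
    DifferentiableOn ℂ (fun z => H2.ev (ContinuousLinearMap.adjoint T f) z -
      H2.ev f 0 / (1 - conj (value φ 0) * z)) disc := by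
  refine (H2.differentiableOn_ev _).sub ((differentiableOn_const _).div (by fun_prop) ?_)
  exact fun z hz => h.one_sub_ne_zero (by simp) hz

theorem _root_.HardyComp.AreBranchesNear.of_mem {F : OnePoint ℂ → OnePoint ℂ} {z v : ℂ} {n : ℕ}
    {V : Set ℂ} {σ : Fin n → ℂ → ℂ} (hσ : AreBranchesNear F z n V σ) (hv : v ∈ V) :
    AreBranchesNear F v n V σ :=
  { hσ with mem := hv }

theorem exists_isOmega (h : Represents φ A B d) {T : H2 →L[ℂ] H2}
    (hT : IsCompositionOperator φ T) (f : H2) :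
    ∃ g, IsOmega φ (f - H2.const (H2.ev f 0)) g := by
  set Ψ : ℂ → ℂ := fun z => H2.ev (ContinuousLinearMap.adjoint T f) z -
      H2.ev f 0 / (1 - conj (value φ 0) * z) with hΨ
  have hΨd : DifferentiableOn ℂ Ψ disc := h.differentiableOn_adjoint_sub T f
  have hΨ0 : Ψ 0 = 0 := by simp [hΨ, h.ev_adjoint_zero hT]
  have hgd : DifferentiableOn ℂ (dslope Ψ 0) disc := differentiableOn_dslope_disc hΨd
  refine ⟨dslope Ψ 0, hgd, fun z hz hr hz0 => ?_⟩
  obtain ⟨V, σ, hσ⟩ := h.exists_areBranchesNear hz hr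
  refine ⟨d, V, σ, hσ, ?_⟩
  rw [h.sum_branches_eq hσ hz0]
  have key : ∀ v ∈ V, v ≠ 0 → IsRegularValue (exteriorMap φ) (v : OnePoint ℂ) →
      dslope Ψ 0 v = ∑ j, deriv (σ j) v * backwardShift (H2.ev f) (σ j v) := by
    intro v hv hv0 hvr
    rw [dslope_of_ne _ hv0, slope_def_field, hΨ0, sub_zero, sub_zero, hΨ]
    simp only
    rw [h.ev_adjoint_eq hT (hσ.of_mem hv) hvr, add_sub_cancel_left, mul_div_cancel_left₀ _ hv0]
  -- At `z = 0` the factor `z` cannot be cancelled; both sides are continuous there and agree at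
  -- nearby nonzero regular values.
  by_cases h0 : z = 0
  · subst h0
    have hev : dslope Ψ 0 =ᶠ[nhdsWithin 0 {0}ᶜ]
        fun v => ∑ j, deriv (σ j) v * backwardShift (H2.ev f) (σ j v) := by
      filter_upwards [h.eventually_isRegularValue hz, self_mem_nhdsWithin,
        nhdsWithin_le_nhds (hσ.isOpen.mem_nhds hσ.mem)] with v hv1 hv2 hv3
      exact key v hv3 hv2 hv1.2
    have hc : ContinuousAt (dslope Ψ 0) 0 :=
      (hgd.differentiableAt (Metric.isOpen_ball.mem_nhds hz)).continuousAt
    exact ((hc.eventuallyEq_nhds_iff_eventuallyEq_nhdsNE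
      (h.continuousAt_sum_branches hσ f)).1 hev).eq_of_nhds
  · exact key z hσ.mem h0 hr

/-- Both sides are continuous and agree on a punctured neighbourhood of `z`. Since `g` is any
function satisfying `IsOmega`, the choice made in `Omega` is immaterial. -/
theorem ev_adjoint_eq_omega (h : Represents φ A B d) {T : H2 →L[ℂ] H2}
    (hT : IsCompositionOperator φ T) {f : H2} {g : ℂ → ℂ}
    (hg : IsOmega φ (f - H2.const (H2.ev f 0)) g) {z : ℂ} (hz : z ∈ disc) :
    H2.ev (ContinuousLinearMap.adjoint T f) z =
      H2.ev f 0 / (1 - conj (value φ 0) * z) + z * g z := by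
  set Ψ : ℂ → ℂ := fun z => H2.ev (ContinuousLinearMap.adjoint T f) z -
      H2.ev f 0 / (1 - conj (value φ 0) * z) with hΨ
  have hzn := Metric.isOpen_ball.mem_nhds hz
  have hc1 : ContinuousAt Ψ z :=
    ((h.differentiableOn_adjoint_sub T f).differentiableAt hzn).continuousAt
  have hc2 : ContinuousAt (fun v => v * g v) z :=
    continuousAt_id.mul (hg.1.differentiableAt hzn).continuousAt
  have hne : ∀ᶠ v : ℂ in nhdsWithin z {z}ᶜ,
      exteriorMap φ ((0 : ℂ) : OnePoint ℂ) ≠ (v : OnePoint ℂ) := by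
    have hsub : {v : ℂ | exteriorMap φ ((0 : ℂ) : OnePoint ℂ) = (v : OnePoint ℂ)}.Subsingleton :=
      fun v hv v' hv' => OnePoint.coe_injective (hv.symm.trans hv')
    filter_upwards [nhdsWithin_le_nhds
      ((hsub.finite.sdiff (t := {z})).isClosed.isOpen_compl.mem_nhds (x := z) (by simp)),
      self_mem_nhdsWithin] with v hv1 hv2 hv3
    exact hv1 ⟨hv3, hv2⟩
  have hev : Ψ =ᶠ[nhdsWithin z {z}ᶜ] fun v => v * g v := by
    filter_upwards [h.eventually_isRegularValue hz, hne] with v ⟨hv, hvr⟩ hv0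
    obtain ⟨n, V, σ, hσ, hsum⟩ := hg.2 v hv hvr hv0
    rw [hsum, h.sum_branches_eq hσ hv0, hΨ]
    simp only
    rw [h.ev_adjoint_eq hT hσ hvr, add_sub_cancel_left]
  have := ((hc1.eventuallyEq_nhds_iff_eventuallyEq_nhdsNE hc2).1 hev).eq_of_nhds
  rw [← this, hΨ]
  simp

end Represents

theorem isCompositionOperator_compositionOperator {φ : RatFunc ℂ} (hφ : φ ∈ RatU) :
    IsCompositionOperator φ (compositionOperator φ) := by
  have hd : DifferentiableOn ℂ (value φ) disc := by
    have h1 : DifferentiableOn ℂ (fun z => φ.num.eval z / φ.denom.eval z) disc :=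
      φ.num.differentiable.differentiableOn.div φ.denom.differentiable.differentiableOn
        fun z hz => (hφ z hz).1
    exact h1
  exact Classical.epsilon_spec (exists_composition_operator hd fun z hz => (hφ z hz).2)

end HardyComp

/-- Besides the two formulas, the conclusion says that the objects in them are well defined: `C_φ`
as a bounded operator on `H²`, the holomorphic function `Ω_φ [f - f(0)]` on the disc, and the
branches of `φₑ⁻¹` near a regular value. -/
theorem corollary3p2 (φ : RatFunc ℂ) (hφ : φ ∈ RatU) :
    IsCompositionOperator φ (compositionOperator φ) ∧
    ∀ f : H2,
      IsOmega φ (f - H2.const (H2.ev f 0)) (Omega φ (f - H2.const (H2.ev f 0))) ∧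
      (∀ z ∈ disc,
        H2.ev (ContinuousLinearMap.adjoint (compositionOperator φ) f) z =
          H2.ev f 0 / (1 - conj (value φ 0) * z) +
            z * Omega φ (f - H2.const (H2.ev f 0)) z) ∧
      (∀ z ∈ disc, IsRegularValue (exteriorMap φ) (z : OnePoint ℂ) →
        (∃ (d : ℕ) (V : Set ℂ) (σ : Fin d → ℂ → ℂ),
          AreBranchesNear (exteriorMap φ) z d V σ) ∧
        ∀ (d : ℕ) (V : Set ℂ) (σ : Fin d → ℂ → ℂ),
          AreBranchesNear (exteriorMap φ) z d V σ →
            H2.ev (ContinuousLinearMap.adjoint (compositionOperator φ) f) z =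
              H2.ev f 0 / (1 - conj (value φ 0) * z) +
                z * ∑ j, deriv (σ j) z * backwardShift (H2.ev f) (σ j z)) := by
  have hT := isCompositionOperator_compositionOperator hφ
  obtain ⟨A, B, hc, he, hd⟩ := hasDegree_exteriorMap φ
  have h : Represents φ A B _ := ⟨hφ, hc, he, hd⟩
  refine ⟨hT, fun f => ?_⟩
  have hΩ : IsOmega φ (f - H2.const (H2.ev f 0)) (Omega φ (f - H2.const (H2.ev f 0))) :=
    Classical.epsilon_spec (h.exists_isOmega hT f)
  refine ⟨hΩ, fun z hz => h.ev_adjoint_eq_omega hT hΩ hz, fun z hz hr => ⟨?_, ?_⟩⟩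
  · exact ⟨_, h.exists_areBranchesNear hz hr⟩
  · exact fun d V σ hσ => h.ev_adjoint_eq hT hσ hr f
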